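/- Let $A=\mathbb Z[x,x^{-1}]$ be the Hopf ring with $\Delta(x)=x\otimes x$, $\epsilon(x)=1$, antipode $x\mapsto x^{-1}$, and let $\gamma:A\otimes A\to\mathbb Z$, $\gamma(x^i\otimes x^j)=(-1)^{ij}$. Then $\gamma$ is a braiding coelement, i.e. it is convolution-invertible and satisfies $x_1y_1\gamma(y_2,x_2)=\gamma(y_1,x_1)y_2x_2$, $\gamma(x,yz)=\gamma(x_1,z)\gamma(x_2,y)$, $\gamma(xy,z)=\gamma(x,z_1)\gamma(y,z_2)$; hence $A$-comodules are braided by $u\otimes v\mapsto\gamma(v_{(-1)},u_{(-1)})\,v_{(0)}\otimes u_{(0)}$. For $s=\pm1$ let $D=\mathbb Z d$ with coaction $d\mapsto x^s\otimes d$ (that is, $\mathbb Z$ in degree $s$). Then $D$ is an $A$-comodule whose braiding $D\otimes D\to D\otimes D$ is $-1$, and $H=D\oplus\mathbb Z$, with $d\cdot d=0$, unit $1$, $\Delta(d)=d\otimes1+1\otimes d$, $\epsilon(d)=0$ and antipode $d\mapsto-d$, is a Hopf monoid in the braided monoidal category of $A$-comodules. Let $Q_s=H\rtimes A$ be the semidirect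 product: the abelian group $H\otimes A$ with $$(h\otimes a)(h'\otimes a')=\gamma(h'_{(-1)},a_1)\,hh'_{(0)}\otimes a_2a',\qquad \delta(h\otimes a)=\big(h_1\otimes (h_2)_{(-1)}a_1\big)\otimes\big((h_2)_{(0)}\otimes a_2\big),$$ unit $1\otimes1$, counit $\epsilon\otimes\epsilon$ and antipode $h\otimes a\mapsto\gamma\big(h_{(-1)},S(h_{(-2)}a_2)\big)\,S(h_{(0)})\otimes S(h_{(-3)}a_1)$. Then $Q_s$ is a Hopf ring in abelian groups and, writing $x^j$ for $1\otimes x^j$, for all $j,k\in\mathbb Z$: * $\epsilon(d\otimes x^j)=0$, $\epsilon(x^j)=1$; $\eta(1)=x^0$; * $\delta(x^j)=x^j\otimes x^j$, $\ \delta(d\otimes x^j)=(d\otimes x^j)\otimes x^j+x^{s+j}\otimes(d\otimes x^j)$; * $(d\otimes x^j)(d\otimes x^k)=0$, $\ (d\otimes x^j)x^k=d\otimes x^{j+k}$, $\ x^j(d\otimes x^k)=(-1)^j\,d\otimes x^{j+k}$, $\ x^jx^k=x^{j+k}$; * the antipode is $d\otimes x^j\mapsto(-1)^j\,d\otimes x^{-j-s}$,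 $\ x^j\mapsto x^{-j}$. Let $P_{(s)}=\mathbb Z\langle\xi,\xi^{-1},\psi\rangle/(\xi\psi+\psi\xi,\psi^2)$ be the Hopf ring with $\Delta(\xi)=\xi\otimes\xi$, $\epsilon(\xi)=1$, $S(\xi)=\xi^{-1}$, $\Delta(\psi)=\psi\otimes1+\xi^{s}\otimes\psi$, $\epsilon(\psi)=0$, $S(\psi)=\psi\xi^{-s}$; thus $P=P_{(-1)}$ is Pareigis's Hopf ring and $P_+=P_{(1)}$ the modified one. Then there is an isomorphism of Hopf rings $Q_s\cong P_{(s)}$ with $x\mapsto\xi$ and $d\otimes x^0\mapsto\psi$. Moreover there is an isomorphism of Hopf rings $P\cong P_+$ that exchanges $\xi$ and $\xi^{-1}$ and sends $\psi\mapsto\psi$. Finally, the monoidal category of left $P$-comodules is monoidally equivalent to that of complexes of abelian groups $\cdots\to C_n\to C_{n+1}\to\cdots$, and the monoidal category of left $P_+$-comodules to that of chain complexes $\cdots\to C_n\to C_{n-1}\to\cdots$, both with $d(a\otimes b)=da\otimes b+(-1)^{i}a\otimes db$ for $a$ of degree $i$. Under the equivalence (for $P$ with $s=-1$, for $P_+$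 with $s=1$) a complex $C$ corresponds to the abelian group $\bigoplus_nC_n$ with the coaction $a\mapsto\xi^n\otimes a+\psi\xi^{n-s}\otimes da$ for $a\in C_n$. -/

import Mathlib

open CategoryTheory MonoidalCategory TensorProduct LaurentPolynomial

universe u v w

noncomputable section

namespace Pareigis

section Comodules

variable {k : Type u} [CommRing k] {C : Type v} [Ring C] [Bialgebra k C]
variable {X Y Z : Type*} [AddCommGroup X] [Module k X] [AddCommGroup Y] [Module k Y]
  [AddCommGroup Z] [Module k Z]

/-- `ρ : X → C ⊗ X` is a (left) coaction of `C` on `X`: it is counital and coassociative. -/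
structure IsCoaction (ρ : X →ₗ[k] C ⊗[k] X) : Prop where
  counit : (TensorProduct.lid k X).toLinearMap ∘ₗ
    (Coalgebra.counit (R := k) (A := C)).rTensor X ∘ₗ ρ = LinearMap.id
  coassoc : (TensorProduct.assoc k C C X).toLinearMap ∘ₗ
    (Coalgebra.comul (R := k) (A := C)).rTensor X ∘ₗ ρ = ρ.lTensor C ∘ₗ ρ

/-- `f` is a morphism of comodules. -/
def IsComodHom (ρX : X →ₗ[k] C ⊗[k] X) (ρY : Y →ₗ[k] C ⊗[k] Y) (f : X →ₗ[k] Y) : Prop :=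
  ρY ∘ₗ f = f.lTensor C ∘ₗ ρX

/-- `(C ⊗ X) ⊗ (C ⊗ Y) → C ⊗ (X ⊗ Y)`, `(c ⊗ x) ⊗ (d ⊗ y) ↦ cd ⊗ (x ⊗ y)`. -/
def mulOut (C : Type v) [Ring C] [Bialgebra k C] (X Y : Type*) [AddCommGroup X] [Module k X]
    [AddCommGroup Y] [Module k Y] : (C ⊗[k] X) ⊗[k] (C ⊗[k] Y) →ₗ[k] C ⊗[k] (X ⊗[k] Y) :=
  (LinearMap.mul' k C).rTensor (X ⊗[k] Y) ∘ₗ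
    (TensorProduct.tensorTensorTensorComm k C X C Y).toLinearMap

/-- The coaction on a tensor product of comodules over a bialgebra:
`x ⊗ y ↦ x₍₋₁₎ y₍₋₁₎ ⊗ (x₍₀₎ ⊗ y₍₀₎)`. -/
def coactTensor (ρX : X →ₗ[k] C ⊗[k] X) (ρY : Y →ₗ[k] C ⊗[k] Y) :
    X ⊗[k] Y →ₗ[k] C ⊗[k] (X ⊗[k] Y) :=
  mulOut C X Y ∘ₗ TensorProduct.map ρX ρY

/-- The coaction `r ↦ 1 ⊗ r` on the unit object `k`. -/
def coactUnit (k : Type u) [CommRing k] (C : Type v) [Ring C] [Bialgebra k C] :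
    k →ₗ[k] C ⊗[k] k :=
  TensorProduct.mk k C k 1

@[simp] theorem mulOut_tmul (c d : C) (x : X) (y : Y) :
    mulOut (k := k) C X Y ((c ⊗ₜ x) ⊗ₜ (d ⊗ₜ y)) = (c * d) ⊗ₜ (x ⊗ₜ y) := rfl

@[simp] theorem coactTensor_tmul (ρX : X →ₗ[k] C ⊗[k] X) (ρY : Y →ₗ[k] C ⊗[k] Y) (x : X) (y : Y) :
    coactTensor ρX ρY (x ⊗ₜ y) = mulOut C X Y (ρX x ⊗ₜ ρY y) := rfl

@[simp] theorem coactUnit_apply (r : k) : coactUnit k C r = 1 ⊗ₜ r := rfl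

theorem isCoaction_unit : IsCoaction (coactUnit k C) where
  counit := by ext; simp
  coassoc := by ext; simp [Algebra.TensorProduct.one_def]

theorem IsCoaction.tensor {ρX : X →ₗ[k] C ⊗[k] X} {ρY : Y →ₗ[k] C ⊗[k] Y}
    (hX : IsCoaction ρX) (hY : IsCoaction ρY) : IsCoaction (coactTensor ρX ρY) where
  counit := by
    have key : ∀ (p : C ⊗[k] X) (q : C ⊗[k] Y),
        TensorProduct.lid k _ ((Coalgebra.counit (R := k) (A := C)).rTensor _
          (mulOut C X Y (p ⊗ₜ q))) =
        (TensorProduct.lid k _ ((Coalgebra.counit (R := k) (A := C)).rTensor _ p)) ⊗ₜ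
        (TensorProduct.lid k _ ((Coalgebra.counit (R := k) (A := C)).rTensor _ q)) := by
      intro p q
      induction p with
      | zero => simp
      | add a b ha hb => simp only [add_tmul, map_add, ha, hb]
      | tmul c x =>
        induction q with
        | zero => simp
        | add a b ha hb => simp only [tmul_add, map_add, ha, hb]
        | tmul d y => simp [mul_smul, smul_comm (Coalgebra.counit (R := k) c), TensorProduct.smul_tmul']
    ext x y
    have h1 := LinearMap.congr_fun hX.counit x
    have h2 := LinearMap.congr_fun hY.counit y
    have := key (ρX x) (ρY y)
    simp only [LinearMap.comp_apply, LinearEquiv.coe_coe, LinearMap.id_apply] at h1 h2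
    rw [h1, h2] at this
    simpa using this
  coassoc := by
    have key : ∀ (p : C ⊗[k] X) (q : C ⊗[k] Y),
        TensorProduct.assoc k C C _ ((Coalgebra.comul (R := k) (A := C)).rTensor _
          (mulOut C X Y (p ⊗ₜ q))) =
        (mulOut C X Y).lTensor C (mulOut C (C ⊗[k] X) (C ⊗[k] Y)
          ((TensorProduct.assoc k C C X ((Coalgebra.comul (R := k) (A := C)).rTensor _ p)) ⊗ₜ
          (TensorProduct.assoc k C C Y ((Coalgebra.comul (R := k) (A := C)).rTensor _ q)))) := by
      intro p q
      induction p with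
      | zero => simp
      | add a b ha hb => simp only [add_tmul, map_add, ha, hb]
      | tmul c x =>
        induction q with
        | zero => simp
        | add a b ha hb => simp only [tmul_add, map_add, ha, hb]
        | tmul d y =>
          rw [mulOut_tmul, LinearMap.rTensor_tmul, LinearMap.rTensor_tmul, LinearMap.rTensor_tmul,
            Bialgebra.comul_mul]
          generalize Coalgebra.comul (R := k) c = c'
          generalize Coalgebra.comul (R := k) d = d'
          induction c' with
          | zero => simp
          | add a b ha hb => simp only [add_tmul, map_add, add_mul, ha, hb]
          | tmul c₁ c₂ =>
            induction d' with
            | zero => simp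
            | add a b ha hb => simp only [tmul_add, add_tmul, map_add, mul_add, ha, hb]
            | tmul d₁ d₂ => simp
    have key2 : ∀ (p : C ⊗[k] X) (q : C ⊗[k] Y),
        (coactTensor ρX ρY).lTensor C (mulOut C X Y (p ⊗ₜ q)) =
        (mulOut C X Y).lTensor C (mulOut C (C ⊗[k] X) (C ⊗[k] Y)
          ((ρX.lTensor C p) ⊗ₜ (ρY.lTensor C q))) := by
      intro p q
      induction p with
      | zero => simp
      | add a b ha hb => simp only [add_tmul, map_add, ha, hb]
      | tmul c x =>
        induction q with
        | zero => simp
        | add a b ha hb => simp only [tmul_add, map_add, ha, hb]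
        | tmul d y => simp
    ext x y
    have h1 := LinearMap.congr_fun hX.coassoc x
    have h2 := LinearMap.congr_fun hY.coassoc y
    simp only [LinearMap.comp_apply, LinearEquiv.coe_coe] at h1 h2
    have := (key (ρX x) (ρY y)).trans (by rw [h1, h2, ← key2])
    simpa using this

theorem IsComodHom.tensor {X' Y' : Type*} [AddCommGroup X'] [Module k X'] [AddCommGroup Y']
    [Module k Y'] {ρX : X →ₗ[k] C ⊗[k] X} {ρY : Y →ₗ[k] C ⊗[k] Y}
    {ρX' : X' →ₗ[k] C ⊗[k] X'} {ρY' : Y' →ₗ[k] C ⊗[k] Y'} {f : X →ₗ[k] X'} {g : Y →ₗ[k] Y'}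
    (hf : IsComodHom ρX ρX' f) (hg : IsComodHom ρY ρY' g) :
    IsComodHom (coactTensor ρX ρY) (coactTensor ρX' ρY') (TensorProduct.map f g) := by
  have key : ∀ (p : C ⊗[k] X) (q : C ⊗[k] Y),
      mulOut C X' Y' (f.lTensor C p ⊗ₜ g.lTensor C q) =
        (TensorProduct.map f g).lTensor C (mulOut C X Y (p ⊗ₜ q)) := by
    intro p q
    induction p with
    | zero => simp
    | add a b ha hb => simp only [add_tmul, map_add, ha, hb]
    | tmul c x =>
      induction q with
      | zero => simp
      | add a b ha hb => simp only [tmul_add, map_add, ha, hb]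
      | tmul d y => simp
  unfold IsComodHom
  ext x y
  have h1 := LinearMap.congr_fun hf x
  have h2 := LinearMap.congr_fun hg y
  simp only [LinearMap.comp_apply] at h1 h2
  simpa [h1, h2] using key (ρX x) (ρY y)

theorem isComodHom_assoc (ρX : X →ₗ[k] C ⊗[k] X) (ρY : Y →ₗ[k] C ⊗[k] Y)
    (ρZ : Z →ₗ[k] C ⊗[k] Z) :
    IsComodHom (coactTensor (coactTensor ρX ρY) ρZ) (coactTensor ρX (coactTensor ρY ρZ))
      (TensorProduct.assoc k X Y Z).toLinearMap := by
  have key : ∀ (p : C ⊗[k] X) (q : C ⊗[k] Y) (r : C ⊗[k] Z),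
      mulOut C X (Y ⊗[k] Z) (p ⊗ₜ mulOut C Y Z (q ⊗ₜ r)) =
        (TensorProduct.assoc k X Y Z).toLinearMap.lTensor C
          (mulOut C (X ⊗[k] Y) Z (mulOut C X Y (p ⊗ₜ q) ⊗ₜ r)) := by
    intro p q r
    induction p with
    | zero => simp
    | add a b ha hb => simp only [add_tmul, map_add, ha, hb]
    | tmul c x =>
      induction q with
      | zero => simp
      | add a b ha hb => simp only [tmul_add, add_tmul, map_add, ha, hb]
      | tmul d y =>
        induction r with
        | zero => simp
        | add a b ha hb => simp only [tmul_add, map_add, ha, hb]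
        | tmul e z => simp [mul_assoc]
  unfold IsComodHom
  ext x y z
  simpa using key (ρX x) (ρY y) (ρZ z)

theorem isComodHom_lid (ρX : X →ₗ[k] C ⊗[k] X) :
    IsComodHom (coactTensor (coactUnit k C) ρX) ρX (TensorProduct.lid k X).toLinearMap := by
  have key : ∀ p : C ⊗[k] X,
      p = (TensorProduct.lid k X).toLinearMap.lTensor C (mulOut C k X ((1 ⊗ₜ 1) ⊗ₜ p)) := by
    intro p
    induction p with
    | zero => simp
    | add a b ha hb => simp only [tmul_add, map_add, ← ha, ← hb]
    | tmul c x => simp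
  unfold IsComodHom
  ext x
  simpa using key (ρX x)

theorem isComodHom_rid (ρX : X →ₗ[k] C ⊗[k] X) :
    IsComodHom (coactTensor ρX (coactUnit k C)) ρX (TensorProduct.rid k X).toLinearMap := by
  have key : ∀ p : C ⊗[k] X,
      p = (TensorProduct.rid k X).toLinearMap.lTensor C (mulOut C X k (p ⊗ₜ (1 ⊗ₜ 1))) := by
    intro p
    induction p with
    | zero => simp
    | add a b ha hb => simp only [add_tmul, map_add, ← ha, ← hb]
    | tmul c x => simp
  unfold IsComodHom
  ext x
  simpa using key (ρX x)

end Comodules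

section Category

variable (k : Type u) [CommRing k] (C : Type u) [Ring C] [Bialgebra k C]

/-- Left comodules over the bialgebra `C`. -/
structure LeftComod where
  /-- the underlying `k`-module -/
  carrier : ModuleCat.{u} k
  /-- the coaction -/
  coact : carrier →ₗ[k] C ⊗[k] carrier
  isCoaction : IsCoaction coact

namespace LeftComod

variable {k C}

/-- Morphisms of comodules. -/
@[ext]
structure Hom (X Y : LeftComod k C) where
  /-- the underlying linear map -/
  hom : X.carrier ⟶ Y.carrier
  isComodHom : IsComodHom X.coact Y.coact hom.hom

instance : Category (LeftComod k C) where
  Hom := Hom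
  id X := ⟨𝟙 _, by unfold IsComodHom; ext; simp⟩
  comp f g := ⟨f.hom ≫ g.hom, by
    have hf := f.isComodHom
    have hg := g.isComodHom
    unfold IsComodHom at *
    rw [ModuleCat.hom_comp, ← LinearMap.comp_assoc, hg, LinearMap.comp_assoc, hf,
      ← LinearMap.comp_assoc, LinearMap.lTensor_comp]⟩

@[ext] theorem hom_ext {X Y : LeftComod k C} {f g : X ⟶ Y} (h : f.hom = g.hom) : f = g :=
  Hom.ext h

@[simp] theorem id_hom (X : LeftComod k C) : Hom.hom (𝟙 X) = 𝟙 X.carrier := rfl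

@[simp] theorem comp_hom {X Y Z : LeftComod k C} (f : X ⟶ Y) (g : Y ⟶ Z) :
    (f ≫ g).hom = f.hom ≫ g.hom := rfl

variable (k C) in
/-- The forgetful functor from comodules to modules. -/
def forget : LeftComod k C ⥤ ModuleCat.{u} k where
  obj X := X.carrier
  map f := f.hom

instance : (forget k C).Faithful where
  map_injective h := hom_ext h

/-- An isomorphism of modules that is a comodule morphism is an isomorphism of comodules. -/
def mkIso {X Y : LeftComod k C} (e : X.carrier ≅ Y.carrier)
    (h : IsComodHom X.coact Y.coact e.hom.hom) : X ≅ Y where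
  hom := ⟨e.hom, h⟩
  inv := ⟨e.inv, by
    have h1 : e.inv.hom ∘ₗ e.hom.hom = LinearMap.id := by
      rw [← ModuleCat.hom_comp, e.hom_inv_id]; rfl
    have h2 : e.hom.hom ∘ₗ e.inv.hom = LinearMap.id := by
      rw [← ModuleCat.hom_comp, e.inv_hom_id]; rfl
    unfold IsComodHom at *
    calc X.coact ∘ₗ e.inv.hom
        = (e.inv.hom ∘ₗ e.hom.hom).lTensor C ∘ₗ X.coact ∘ₗ e.inv.hom := by
          rw [h1, LinearMap.lTensor_id, LinearMap.id_comp]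
      _ = e.inv.hom.lTensor C ∘ₗ (e.hom.hom.lTensor C ∘ₗ X.coact) ∘ₗ e.inv.hom := by
          rw [LinearMap.lTensor_comp]; rfl
      _ = e.inv.hom.lTensor C ∘ₗ Y.coact ∘ₗ (e.hom.hom ∘ₗ e.inv.hom) := by rw [← h]; rfl
      _ = _ := by rw [h2]; rfl⟩
  hom_inv_id := hom_ext e.hom_inv_id
  inv_hom_id := hom_ext e.inv_hom_id

instance : MonoidalCategoryStruct (LeftComod k C) where
  tensorObj X Y := ⟨X.carrier ⊗ Y.carrier, coactTensor X.coact Y.coact,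
    X.isCoaction.tensor Y.isCoaction⟩
  tensorHom f g := ⟨f.hom ⊗ₘ g.hom, f.isComodHom.tensor g.isComodHom⟩
  whiskerLeft X _ _ f := ⟨X.carrier ◁ f.hom, (𝟙 X : X ⟶ X).isComodHom.tensor f.isComodHom⟩
  whiskerRight f X := ⟨f.hom ▷ X.carrier, f.isComodHom.tensor (𝟙 X : X ⟶ X).isComodHom⟩
  tensorUnit := ⟨𝟙_ _, coactUnit k C, isCoaction_unit⟩
  associator X Y Z := mkIso (α_ X.carrier Y.carrier Z.carrier)
    (isComodHom_assoc X.coact Y.coact Z.coact)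
  leftUnitor X := mkIso (λ_ X.carrier) (isComodHom_lid X.coact)
  rightUnitor X := mkIso (ρ_ X.carrier) (isComodHom_rid X.coact)

/-- The monoidal category of comodules over a bialgebra, with the tensor product of `k`-modules. -/
instance : MonoidalCategory (LeftComod k C) :=
  Monoidal.induced (forget k C)
    { μIso := fun _ _ => Iso.refl _
      εIso := Iso.refl _
      whiskerLeft_eq X Y₁ Y₂ f := by
        change X.carrier ◁ f.hom = 𝟙 _ ≫ X.carrier ◁ f.hom ≫ 𝟙 _
        simp
      whiskerRight_eq f Y := by
        change f.hom ▷ Y.carrier = 𝟙 _ ≫ f.hom ▷ Y.carrier ≫ 𝟙 _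
        simp
      tensorHom_eq f g := by
        change f.hom ⊗ₘ g.hom = 𝟙 _ ≫ (f.hom ⊗ₘ g.hom) ≫ 𝟙 _
        simp
      associator_eq X Y Z := by
        change (α_ X.carrier Y.carrier Z.carrier).hom = (𝟙 _ ≫ (𝟙 _ ⊗ₘ 𝟙 _)) ≫
          (α_ X.carrier Y.carrier Z.carrier).hom ≫ (𝟙 _ ⊗ₘ 𝟙 _) ≫ 𝟙 _
        simp
      leftUnitor_eq X := by
        change (λ_ X.carrier).hom = (𝟙 _ ≫ (𝟙 _ ⊗ₘ 𝟙 _)) ≫ (λ_ X.carrier).hom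
        simp
      rightUnitor_eq X := by
        change (ρ_ X.carrier).hom = (𝟙 _ ≫ (𝟙 _ ⊗ₘ 𝟙 _)) ≫ (ρ_ X.carrier).hom
        simp }

end LeftComod
end Category
section PareigisAlgebra

variable (k : Type u) [CommRing k]

/-- The three generators `ξ`, `ξ⁻¹`, `ψ`. -/
inductive Gen : Type u
  | xi | xiInv | psi

/-- The relations of `k⟨ξ, ξ⁻¹, ψ⟩ / (ξψ + ψξ, ψ²)`, as a quotient of the free algebra. -/
inductive Rel : FreeAlgebra k Gen.{u} → FreeAlgebra k Gen.{u} → Prop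
  | xi_mul_xiInv : Rel (FreeAlgebra.ι k Gen.xi * FreeAlgebra.ι k Gen.xiInv) 1
  | xiInv_mul_xi : Rel (FreeAlgebra.ι k Gen.xiInv * FreeAlgebra.ι k Gen.xi) 1
  | anticomm : Rel (FreeAlgebra.ι k Gen.xi * FreeAlgebra.ι k Gen.psi
      + FreeAlgebra.ι k Gen.psi * FreeAlgebra.ι k Gen.xi) 0
  | psi_sq : Rel (FreeAlgebra.ι k Gen.psi * FreeAlgebra.ι k Gen.psi) 0

/-- The algebra `k⟨ξ, ξ⁻¹, ψ⟩ / (ξψ + ψξ, ψ²)`. The parameter `s = ±1` does not affect the algebra;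
it selects the Hopf structure put on it below: `Par ℤ (-1)` is the Hopf ring `P` of Pareigis, with
`Δ(ψ) = ψ ⊗ 1 + ξ⁻¹ ⊗ ψ` and `S(ψ) = ψ ξ`, and `Par ℤ 1` is the modified Hopf ring `P₊`, with
`Δ(ψ) = ψ ⊗ 1 + ξ ⊗ ψ` and `S(ψ) = ψ ξ⁻¹`. -/
def Par (_s : ℤˣ) : Type u := RingQuot (Rel k)

variable (s : ℤˣ)

namespace Par

instance : Ring (Par k s) := inferInstanceAs (Ring (RingQuot (Rel k)))

/-- The `k`-algebra structure on `Par k s`. -/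
instance instAlgebra : Algebra k (Par k s) := inferInstanceAs (Algebra k (RingQuot (Rel k)))

/-- The quotient map from the free algebra. -/
def mk : FreeAlgebra k Gen.{u} →ₐ[k] Par k s := RingQuot.mkAlgHom k (Rel k)

theorem mk_rel {a b : FreeAlgebra k Gen.{u}} (h : Rel k a b) : mk k s a = mk k s b :=
  RingQuot.mkAlgHom_rel k h

/-- The class of a generator. -/
def gen (g : Gen.{u}) : Par k s := mk k s (FreeAlgebra.ι k g)

theorem gen_xi_mul : gen k s .xi * gen k s .xiInv = 1 := by
  simpa [gen] using mk_rel k s (Rel.xi_mul_xiInv (k := k))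

theorem gen_xiInv_mul : gen k s .xiInv * gen k s .xi = 1 := by
  simpa [gen] using mk_rel k s (Rel.xiInv_mul_xi (k := k))

/-- `ξ` as a unit, with inverse `ξ⁻¹`. -/
def xi : (Par k s)ˣ := ⟨gen k s .xi, gen k s .xiInv, gen_xi_mul k s, gen_xiInv_mul k s⟩

/-- The generator `ψ`. -/
def psi : Par k s := gen k s .psi

theorem xi_mul_psi : (xi k s : Par k s) * psi k s = -(psi k s * xi k s) := by
  rw [eq_neg_iff_add_eq_zero]
  simpa [gen, xi, psi] using mk_rel k s (Rel.anticomm (k := k))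

theorem psi_mul_psi : psi k s * psi k s = 0 := by
  simpa [gen, psi] using mk_rel k s (Rel.psi_sq (k := k))

variable {k s}

/-- The universal property of `k⟨ξ, ξ⁻¹, ψ⟩ / (ξψ + ψξ, ψ²)`. -/
def lift {B : Type v} [Ring B] [Algebra k B] (a : Bˣ) (b : B)
    (hab : (a : B) * b = -(b * a)) (hb : b * b = 0) : Par k s →ₐ[k] B :=
  RingQuot.liftAlgHom k ⟨FreeAlgebra.lift k fun g => match g with
    | .xi => (a : B)
    | .xiInv => ((a⁻¹ : Bˣ) : B)
    | .psi => b, by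
      rintro _ _ (_ | _ | _ | _) <;> simp [hab, hb]⟩

@[simp] theorem lift_xi {B : Type v} [Ring B] [Algebra k B] (a : Bˣ) (b : B)
    (hab : (a : B) * b = -(b * a)) (hb : b * b = 0) :
    lift (k := k) (s := s) a b hab hb (xi k s) = a := by
  change RingQuot.liftAlgHom k _ (RingQuot.mkAlgHom k (Rel k) _) = _
  rw [RingQuot.liftAlgHom_mkAlgHom_apply]
  simp

@[simp] theorem lift_psi {B : Type v} [Ring B] [Algebra k B] (a : Bˣ) (b : B)
    (hab : (a : B) * b = -(b * a)) (hb : b * b = 0) :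
    lift (k := k) (s := s) a b hab hb (psi k s) = b := by
  change RingQuot.liftAlgHom k _ (RingQuot.mkAlgHom k (Rel k) _) = _
  rw [RingQuot.liftAlgHom_mkAlgHom_apply]
  simp

@[elab_as_elim]
theorem induction {p : Par k s → Prop} (hk : ∀ r : k, p (algebraMap k _ r))
    (hxi : p (xi k s)) (hxiInv : p ((xi k s)⁻¹ : (Par k s)ˣ)) (hpsi : p (psi k s))
    (hadd : ∀ a b, p a → p b → p (a + b)) (hmul : ∀ a b, p a → p b → p (a * b))
    (a : Par k s) : p a := by
  obtain ⟨a, rfl⟩ : ∃ b, mk k s b = a := RingQuot.mkAlgHom_surjective k (Rel k) a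
  induction a using FreeAlgebra.induction with
  | grade0 r => simpa using hk r
  | grade1 g => cases g; exacts [hxi, hxiInv, hpsi]
  | mul a b ha hb => rw [map_mul]; exact hmul _ _ ha hb
  | add a b ha hb => rw [map_add]; exact hadd _ _ ha hb

theorem algHom_ext {B : Type v} [Ring B] [Algebra k B] {f g : Par k s →ₐ[k] B}
    (hxi : f (xi k s) = g (xi k s)) (hpsi : f (psi k s) = g (psi k s)) : f = g := by
  ext a
  induction a using Par.induction with
  | hk r => simp
  | hxi => exact hxi
  | hxiInv =>
    have : Units.map (f : Par k s →* B) (xi k s) = Units.map (g : Par k s →* B) (xi k s) :=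
      Units.ext hxi
    have := congrArg (fun u : Bˣ => ((u⁻¹ : Bˣ) : B)) this
    simpa [← map_inv] using this
  | hpsi => exact hpsi
  | hadd a b ha hb => simp [ha, hb]
  | hmul a b ha hb => simp [ha, hb]

theorem xiInv_mul_psi : (((xi k s)⁻¹ : (Par k s)ˣ) : Par k s) * psi k s
    = -(psi k s * ((xi k s)⁻¹ : (Par k s)ˣ)) := by
  have h := xi_mul_psi k s
  apply (xi k s).isUnit.mul_left_cancel
  rw [Units.mul_inv_cancel_left, mul_neg, ← mul_assoc, h]
  simp [mul_assoc]

theorem xi_zpow_mul_psi : (((xi k s) ^ (s : ℤ) : (Par k s)ˣ) : Par k s) * psi k s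
    = -(psi k s * ((xi k s) ^ (s : ℤ) : (Par k s)ˣ)) := by
  have h1 := xi_mul_psi k s
  have h2 := xiInv_mul_psi (k := k) (s := s)
  obtain h | h := Int.units_eq_one_or s <;> simp_all

theorem xi_zpow_neg_mul_psi : (((xi k s) ^ (-s : ℤ) : (Par k s)ˣ) : Par k s) * psi k s
    = -(psi k s * ((xi k s) ^ (-s : ℤ) : (Par k s)ˣ)) := by
  have h1 := xi_mul_psi k s
  have h2 := xiInv_mul_psi (k := k) (s := s)
  obtain h | h := Int.units_eq_one_or s <;> simp_all

variable (k s)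

/-- The element `ξ ⊗ ξ` as a unit of `Par k s ⊗ Par k s`. -/
def xiXi : (Par k s ⊗[k] Par k s)ˣ where
  val := (xi k s : Par k s) ⊗ₜ (xi k s : Par k s)
  inv := (((xi k s)⁻¹ : (Par k s)ˣ) : Par k s) ⊗ₜ (((xi k s)⁻¹ : (Par k s)ˣ) : Par k s)
  val_inv := by simp [Algebra.TensorProduct.one_def]
  inv_val := by simp [Algebra.TensorProduct.one_def]

theorem xi_comm_zpow (n : ℤ) : (xi k s : Par k s) * ((xi k s) ^ n : (Par k s)ˣ)
    = ((xi k s) ^ n : (Par k s)ˣ) * xi k s := by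
  rw [← Units.val_mul, ← Units.val_mul, (Commute.self_zpow (xi k s) n).eq]

/-- The comultiplication: `Δ(ξ) = ξ ⊗ ξ`, `Δ(ψ) = ψ ⊗ 1 + ξ^s ⊗ ψ`. -/
def comulHom : Par k s →ₐ[k] Par k s ⊗[k] Par k s :=
  lift (xiXi k s)
    (psi k s ⊗ₜ 1 + (((xi k s) ^ (s : ℤ) : (Par k s)ˣ) : Par k s) ⊗ₜ psi k s)
    (by
      simp only [xiXi, mul_add, add_mul, Algebra.TensorProduct.tmul_mul_tmul, mul_one, one_mul,
        xi_mul_psi, xi_comm_zpow, TensorProduct.neg_tmul, TensorProduct.tmul_neg]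
      abel)
    (by
      simp only [mul_add, add_mul, Algebra.TensorProduct.tmul_mul_tmul, mul_one, one_mul,
        psi_mul_psi, xi_zpow_mul_psi, TensorProduct.neg_tmul, TensorProduct.tmul_zero,
        TensorProduct.zero_tmul]
      abel)

/-- The counit: `ε(ξ) = 1`, `ε(ψ) = 0`. -/
def counitHom : Par k s →ₐ[k] k := lift 1 0 (by simp) (by simp)

/-- The antipode as a homomorphism to the opposite algebra: `ξ ↦ ξ⁻¹`, `ψ ↦ ψ ξ^(-s)`. -/
def antipodeHom : Par k s →ₐ[k] (Par k s)ᵐᵒᵖ :=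
  lift (Units.opEquiv.symm (MulOpposite.op (xi k s)⁻¹))
    (MulOpposite.op (psi k s * ((xi k s) ^ (-s : ℤ) : (Par k s)ˣ)))
    (by
      have h := xiInv_mul_psi (k := k) (s := s)
      have h2 : (((xi k s)⁻¹ : (Par k s)ˣ) : Par k s) * ((xi k s) ^ (-s : ℤ) : (Par k s)ˣ)
          = ((xi k s) ^ (-s : ℤ) : (Par k s)ˣ) * ((xi k s)⁻¹ : (Par k s)ˣ) := by
        rw [← Units.val_mul, ← Units.val_mul,
          ((Commute.self_zpow (xi k s) (-s : ℤ)).inv_left).eq]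
      rw [Units.coe_opEquiv_symm, MulOpposite.unop_op, ← MulOpposite.op_mul,
        ← MulOpposite.op_mul, ← MulOpposite.op_neg, ← mul_assoc, h, mul_assoc, ← h2]
      simp [mul_assoc])
    (by
      rw [← MulOpposite.op_mul, mul_assoc,
        ← mul_assoc (((xi k s) ^ (-s : ℤ) : (Par k s)ˣ) : Par k s), xi_zpow_neg_mul_psi,
        neg_mul, mul_neg, ← mul_assoc, ← mul_assoc, psi_mul_psi]
      simp)

/-- The antipode as a linear map. -/
def antipodeLin : Par k s →ₗ[k] Par k s :=
  (MulOpposite.opLinearEquiv k).symm.toLinearMap ∘ₗ (antipodeHom k s).toLinearMap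

@[simp] theorem comulHom_xi : comulHom k s (xi k s) = (xi k s : Par k s) ⊗ₜ (xi k s : Par k s) :=
  lift_xi ..

@[simp] theorem comulHom_psi : comulHom k s (psi k s) =
    psi k s ⊗ₜ 1 + (((xi k s) ^ (s : ℤ) : (Par k s)ˣ) : Par k s) ⊗ₜ psi k s := lift_psi ..

@[simp] theorem counitHom_xi : counitHom k s (xi k s) = 1 := by simp [counitHom]

@[simp] theorem counitHom_psi : counitHom k s (psi k s) = 0 := by simp [counitHom]

theorem map_xi_zpow {B : Type v} [Ring B] [Algebra k B] (f : Par k s →ₐ[k] B) (b : Bˣ)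
    (h : f (xi k s) = b) (n : ℤ) : f ((xi k s) ^ n : (Par k s)ˣ) = (b ^ n : Bˣ) := by
  have : Units.map (f : Par k s →* B) (xi k s) = b := Units.ext h
  rw [← this, ← map_zpow]; rfl

theorem comulHom_xi_zpow (n : ℤ) : comulHom k s ((xi k s) ^ n : (Par k s)ˣ) =
    (((xi k s) ^ n : (Par k s)ˣ) : Par k s) ⊗ₜ (((xi k s) ^ n : (Par k s)ˣ) : Par k s) := by
  rw [map_xi_zpow k s (comulHom k s) (xiXi k s) (comulHom_xi k s)]
  have key : ∀ m : ℕ, ((xiXi k s ^ m : (Par k s ⊗[k] Par k s)ˣ) : Par k s ⊗[k] Par k s) =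
      (((xi k s) ^ m : (Par k s)ˣ) : Par k s) ⊗ₜ (((xi k s) ^ m : (Par k s)ˣ) : Par k s) := by
    intro m
    simp [xiXi, Algebra.TensorProduct.tmul_pow]
  have key' : ∀ m : ℕ, (((xiXi k s)⁻¹ ^ m : (Par k s ⊗[k] Par k s)ˣ) : Par k s ⊗[k] Par k s) =
      (((xi k s)⁻¹ ^ m : (Par k s)ˣ) : Par k s) ⊗ₜ (((xi k s)⁻¹ ^ m : (Par k s)ˣ) : Par k s) := by
    intro m
    rw [Units.val_pow_eq_pow_val, Units.val_pow_eq_pow_val]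
    exact Algebra.TensorProduct.tmul_pow _ _ _
  obtain ⟨m, rfl | rfl⟩ := n.eq_nat_or_neg
  · simpa using key m
  · simpa using key' m

theorem counitHom_xi_zpow (n : ℤ) : counitHom k s ((xi k s) ^ n : (Par k s)ˣ) = 1 := by
  rw [map_xi_zpow k s (counitHom k s) 1 (by simp)]; simp

/-- The bialgebra structure on `Par k s`. -/
instance instBialgebra : Bialgebra k (Par k s) :=
  Bialgebra.ofAlgHom (comulHom k s) (counitHom k s)
    (algHom_ext (by simp) (by simp [comulHom_xi_zpow, TensorProduct.add_tmul,
      TensorProduct.tmul_add, Algebra.TensorProduct.one_def, add_assoc]))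
    (algHom_ext (by simp) (by simp [counitHom_xi_zpow]))
    (algHom_ext (by simp) (by simp))

theorem comul_eq (a : Par k s) : Coalgebra.comul (R := k) a = comulHom k s a := rfl

theorem counit_eq (a : Par k s) : Coalgebra.counit (R := k) a = counitHom k s a := rfl

theorem antipodeLin_mul (a b : Par k s) :
    antipodeLin k s (a * b) = antipodeLin k s b * antipodeLin k s a := by
  simp [antipodeLin]

@[simp] theorem antipodeLin_one : antipodeLin k s 1 = 1 := by simp [antipodeLin]

@[simp] theorem antipodeLin_xi : antipodeLin k s (xi k s) = ((xi k s)⁻¹ : (Par k s)ˣ) := by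
  rw [antipodeLin, LinearMap.comp_apply, AlgHom.toLinearMap_apply, antipodeHom, lift_xi]
  rfl

@[simp] theorem antipodeLin_psi : antipodeLin k s (psi k s) =
    psi k s * ((xi k s) ^ (-s : ℤ) : (Par k s)ˣ) := by
  simp [antipodeLin, antipodeHom]

theorem antipodeLin_xi_zpow (n : ℤ) : antipodeLin k s ((xi k s) ^ n : (Par k s)ˣ) =
    ((xi k s) ^ (-n) : (Par k s)ˣ) := by
  have h := map_xi_zpow k s (antipodeHom k s) (Units.opEquiv.symm (MulOpposite.op (xi k s)⁻¹))
    (lift_xi ..) n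
  simp only [antipodeLin, LinearMap.comp_apply, AlgHom.toLinearMap_apply, h]
  rw [← map_zpow, ← MulOpposite.op_zpow, zpow_neg, ← inv_zpow]
  rfl

theorem antipode_left_mul {a b : Par k s}
    (ha : LinearMap.mul' k _ ((antipodeLin k s).rTensor _ (comulHom k s a))
      = algebraMap k _ (counitHom k s a))
    (hb : LinearMap.mul' k _ ((antipodeLin k s).rTensor _ (comulHom k s b))
      = algebraMap k _ (counitHom k s b)) :
    LinearMap.mul' k _ ((antipodeLin k s).rTensor _ (comulHom k s (a * b)))
      = algebraMap k _ (counitHom k s (a * b)) := by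
  have key : ∀ (x : Par k s ⊗[k] Par k s) (c d : Par k s),
      LinearMap.mul' k _ ((antipodeLin k s).rTensor _ (x * (c ⊗ₜ d))) =
        antipodeLin k s c * LinearMap.mul' k _ ((antipodeLin k s).rTensor _ x) * d := by
    intro x c d
    induction x with
    | zero => simp
    | tmul e f => simp [antipodeLin_mul, mul_assoc]
    | add x y hx hy => simp only [add_mul, map_add, hx, hy, mul_add]
  have key2 : ∀ y : Par k s ⊗[k] Par k s,
      LinearMap.mul' k _ ((antipodeLin k s).rTensor _ (comulHom k s a * y)) =
        algebraMap k _ (counitHom k s a) *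
          LinearMap.mul' k _ ((antipodeLin k s).rTensor _ y) := by
    intro y
    induction y with
    | zero => simp
    | tmul c d =>
      rw [key, ha, ← Algebra.commutes]
      simp [mul_assoc]
    | add x y hx hy => simp only [mul_add, map_add, hx, hy]
  rw [map_mul, key2, hb, map_mul, map_mul]

theorem antipode_right_mul {a b : Par k s}
    (ha : LinearMap.mul' k _ ((antipodeLin k s).lTensor _ (comulHom k s a))
      = algebraMap k _ (counitHom k s a))
    (hb : LinearMap.mul' k _ ((antipodeLin k s).lTensor _ (comulHom k s b))
      = algebraMap k _ (counitHom k s b)) :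
    LinearMap.mul' k _ ((antipodeLin k s).lTensor _ (comulHom k s (a * b)))
      = algebraMap k _ (counitHom k s (a * b)) := by
  have key : ∀ (x : Par k s ⊗[k] Par k s) (c d : Par k s),
      LinearMap.mul' k _ ((antipodeLin k s).lTensor _ ((c ⊗ₜ d) * x)) =
        c * LinearMap.mul' k _ ((antipodeLin k s).lTensor _ x) * antipodeLin k s d := by
    intro x c d
    induction x with
    | zero => simp
    | tmul e f => simp [antipodeLin_mul, mul_assoc]
    | add x y hx hy => simp only [add_mul, map_add, hx, hy, mul_add]
  have key2 : ∀ y : Par k s ⊗[k] Par k s,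
      LinearMap.mul' k _ ((antipodeLin k s).lTensor _ (y * comulHom k s b)) =
        LinearMap.mul' k _ ((antipodeLin k s).lTensor _ y) *
          algebraMap k _ (counitHom k s b) := by
    intro y
    induction y with
    | zero => simp
    | tmul c d =>
      rw [key, hb, mul_assoc, Algebra.commutes]
      simp [mul_assoc]
    | add x y hx hy => simp only [add_mul, map_add, hx, hy]
  rw [map_mul, key2, ha, map_mul, map_mul]

/-- The Hopf algebra structure on `Par k s`: `Δ(ξ) = ξ ⊗ ξ`, `ε(ξ) = 1`, `S(ξ) = ξ⁻¹`,
`Δ(ψ) = ψ ⊗ 1 + ξ^s ⊗ ψ`, `ε(ψ) = 0`, `S(ψ) = ψ ξ^(-s)`. -/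
instance instHopfAlgebra : HopfAlgebra k (Par k s) where
  antipode := antipodeLin k s
  mul_antipode_rTensor_comul := by
    ext a
    change LinearMap.mul' k _ ((antipodeLin k s).rTensor _ (comulHom k s a))
      = algebraMap k _ (counitHom k s a)
    induction a using Par.induction with
    | hk r => simp [Algebra.algebraMap_eq_smul_one, Algebra.TensorProduct.one_def]
    | hxi => simp
    | hxiInv =>
      have h1 := comulHom_xi_zpow k s (-1)
      have h2 := counitHom_xi_zpow k s (-1)
      have h3 := antipodeLin_xi_zpow k s (-1)
      simp_all
    | hpsi =>
      have h3 := antipodeLin_xi_zpow k s s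
      have h4 := xi_zpow_neg_mul_psi (k := k) (s := s)
      simp_all
    | hadd a b ha hb => simp only [map_add, ha, hb]
    | hmul a b ha hb => exact antipode_left_mul k s ha hb
  mul_antipode_lTensor_comul := by
    ext a
    change LinearMap.mul' k _ ((antipodeLin k s).lTensor _ (comulHom k s a))
      = algebraMap k _ (counitHom k s a)
    induction a using Par.induction with
    | hk r => simp [Algebra.algebraMap_eq_smul_one, Algebra.TensorProduct.one_def]
    | hxi => simp
    | hxiInv =>
      have h1 := comulHom_xi_zpow k s (-1)
      have h2 := counitHom_xi_zpow k s (-1)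
      have h3 := antipodeLin_xi_zpow k s (-1)
      simp_all
    | hpsi =>
      have h4 := xi_zpow_mul_psi (k := k) (s := s)
      rw [comulHom_psi]
      simp only [map_add, LinearMap.lTensor_tmul, antipodeLin_psi, antipodeLin_one,
        LinearMap.mul'_apply, mul_one, ← mul_assoc, h4, counitHom_psi, map_zero]
      simp [mul_assoc]
    | hadd a b ha hb => simp only [map_add, ha, hb]
    | hmul a b ha hb => exact antipode_right_mul k s ha hb

theorem comul_xi : Coalgebra.comul (R := k) (xi k s : Par k s) =
    (xi k s : Par k s) ⊗ₜ (xi k s : Par k s) :=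
  comulHom_xi k s

theorem counit_xi : Coalgebra.counit (R := k) (xi k s : Par k s) = 1 := counitHom_xi k s

theorem antipode_xi : HopfAlgebra.antipode k (xi k s : Par k s) = ((xi k s)⁻¹ : (Par k s)ˣ) :=
  antipodeLin_xi k s

theorem comul_psi_neg : Coalgebra.comul (R := k) (psi k (-1)) = psi k (-1) ⊗ₜ 1 +
    (((xi k (-1))⁻¹ : (Par k (-1))ˣ) : Par k (-1)) ⊗ₜ psi k (-1) := by
  exact (comulHom_psi k (-1)).trans (by simp)

theorem comul_psi_pos : Coalgebra.comul (R := k) (psi k 1) = psi k 1 ⊗ₜ 1 +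
    (xi k 1 : Par k 1) ⊗ₜ psi k 1 := by
  exact (comulHom_psi k 1).trans (by simp)

theorem counit_psi : Coalgebra.counit (R := k) (psi k s) = 0 := counitHom_psi k s

theorem antipode_psi_neg : HopfAlgebra.antipode k (psi k (-1)) = psi k (-1) * xi k (-1) := by
  exact (antipodeLin_psi k (-1)).trans (by simp)

theorem antipode_psi_pos :
    HopfAlgebra.antipode k (psi k 1) = psi k 1 * ((xi k 1)⁻¹ : (Par k 1)ˣ) := by
  exact (antipodeLin_psi k 1).trans (by simp)

end Par
end PareigisAlgebra

section Semidirect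

variable {k : Type u} [CommRing k]

/-- `1 ⊗ f ⊗ 1` applied to the two middle factors of a fourfold tensor product. -/
def middle {X Y Z W U V : Type*} [AddCommGroup X] [Module k X] [AddCommGroup Y] [Module k Y]
    [AddCommGroup Z] [Module k Z] [AddCommGroup W] [Module k W] [AddCommGroup U] [Module k U]
    [AddCommGroup V] [Module k V] (f : Y ⊗[k] Z →ₗ[k] U ⊗[k] V) :
    (X ⊗[k] Y) ⊗[k] (Z ⊗[k] W) →ₗ[k] (X ⊗[k] U) ⊗[k] (V ⊗[k] W) :=
  (TensorProduct.assoc k X U (V ⊗[k] W)).symm.toLinearMap ∘ₗ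
    ((TensorProduct.assoc k U V W).toLinearMap ∘ₗ f.rTensor W ∘ₗ
      (TensorProduct.assoc k Y Z W).symm.toLinearMap).lTensor X ∘ₗ
    (TensorProduct.assoc k X Y (Z ⊗[k] W)).toLinearMap

/-- The structure maps of a Hopf monoid on a `k`-module `M`; the axioms are `IsHopfMonoid`. -/
structure HopfData (k : Type u) [CommRing k] (M : Type w) [AddCommGroup M] [Module k M] where
  /-- multiplication `μ` -/
  mul : M ⊗[k] M →ₗ[k] M
  /-- unit `η` -/
  unit : k →ₗ[k] M
  /-- comultiplication `δ` -/
  comul : M →ₗ[k] M ⊗[k] M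
  /-- counit `ε` -/
  counit : M →ₗ[k] k
  /-- antipode -/
  antipode : M →ₗ[k] M

/-- The axioms of a Hopf monoid, where `β : M ⊗ M → M ⊗ M` is the braiding of `M` with itself in the
braided monoidal category in question. -/
structure HopfData.IsHopfMonoid {M : Type w} [AddCommGroup M] [Module k M] (H : HopfData k M)
    (β : M ⊗[k] M →ₗ[k] M ⊗[k] M) : Prop where
  mul_assoc : H.mul ∘ₗ H.mul.rTensor M =
    H.mul ∘ₗ H.mul.lTensor M ∘ₗ (TensorProduct.assoc k M M M).toLinearMap
  unit_mul : H.mul ∘ₗ H.unit.rTensor M = (TensorProduct.lid k M).toLinearMap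
  mul_unit : H.mul ∘ₗ H.unit.lTensor M = (TensorProduct.rid k M).toLinearMap
  coassoc : (TensorProduct.assoc k M M M).toLinearMap ∘ₗ H.comul.rTensor M ∘ₗ H.comul =
    H.comul.lTensor M ∘ₗ H.comul
  counit_comul : (TensorProduct.lid k M).toLinearMap ∘ₗ H.counit.rTensor M ∘ₗ H.comul =
    LinearMap.id
  comul_counit : (TensorProduct.rid k M).toLinearMap ∘ₗ H.counit.lTensor M ∘ₗ H.comul =
    LinearMap.id
  counit_unit : H.counit ∘ₗ H.unit = LinearMap.id
  counit_mul : H.counit ∘ₗ H.mul = LinearMap.mul' k k ∘ₗ TensorProduct.map H.counit H.counit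
  comul_unit : H.comul ∘ₗ H.unit =
    TensorProduct.map H.unit H.unit ∘ₗ (TensorProduct.lid k k).symm.toLinearMap
  comul_mul : H.comul ∘ₗ H.mul =
    TensorProduct.map H.mul H.mul ∘ₗ middle β ∘ₗ TensorProduct.map H.comul H.comul
  antipode_left : H.mul ∘ₗ H.antipode.rTensor M ∘ₗ H.comul = H.unit ∘ₗ H.counit
  antipode_right : H.mul ∘ₗ H.antipode.lTensor M ∘ₗ H.comul = H.unit ∘ₗ H.counit

/-- A Hopf ring in the symmetric monoidal category of `k`-modules. -/
def HopfData.IsHopfRing {M : Type w} [AddCommGroup M] [Module k M] (H : HopfData k M) : Prop :=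
  H.IsHopfMonoid (TensorProduct.comm k M M).toLinearMap

/-- An isomorphism of Hopf rings. -/
structure HopfIso {M : Type v} [AddCommGroup M] [Module k M] {N : Type w} [AddCommGroup N]
    [Module k N] (H : HopfData k M) (K : HopfData k N) extends M ≃ₗ[k] N where
  map_mul : toLinearMap ∘ₗ H.mul = K.mul ∘ₗ TensorProduct.map toLinearMap toLinearMap
  map_unit : toLinearMap ∘ₗ H.unit = K.unit
  map_comul : K.comul ∘ₗ toLinearMap = TensorProduct.map toLinearMap toLinearMap ∘ₗ H.comul
  map_counit : K.counit ∘ₗ toLinearMap = H.counit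
  map_antipode : K.antipode ∘ₗ toLinearMap = toLinearMap ∘ₗ H.antipode

/-- The structure maps of a Hopf algebra. -/
def HopfData.of (k : Type u) [CommRing k] (A : Type v) [Ring A] [HopfAlgebra k A] :
    HopfData k A where
  mul := LinearMap.mul' k A
  unit := Algebra.linearMap k A
  comul := Coalgebra.comul
  counit := Coalgebra.counit
  antipode := HopfAlgebra.antipode k

variable {A : Type v} [Ring A] [HopfAlgebra k A]

/-- The convolution product of two linear forms on `A ⊗ A`. -/
def conv (γ γ' : A ⊗[k] A →ₗ[k] k) : A ⊗[k] A →ₗ[k] k :=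
  LinearMap.mul' k k ∘ₗ TensorProduct.map γ γ' ∘ₗ
    (TensorProduct.tensorTensorTensorComm k A A A A).toLinearMap ∘ₗ
    TensorProduct.map Coalgebra.comul Coalgebra.comul

/-- `γ : A ⊗ A → k` is a braiding coelement. In Sweedler notation:
`x₁ y₁ γ(y₂, x₂) = γ(y₁, x₁) y₂ x₂`, `γ(x, yz) = γ(x₁, z) γ(x₂, y)`,
`γ(xy, z) = γ(x, z₁) γ(y, z₂)`, and `γ` is invertible for convolution. -/
structure IsBraidingCoelement (γ : A ⊗[k] A →ₗ[k] k) : Prop where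
  mul_comm : (TensorProduct.rid k A).toLinearMap ∘ₗ
      TensorProduct.map (LinearMap.mul' k A) (γ ∘ₗ (TensorProduct.comm k A A).toLinearMap) ∘ₗ
      (TensorProduct.tensorTensorTensorComm k A A A A).toLinearMap ∘ₗ
      TensorProduct.map Coalgebra.comul Coalgebra.comul =
    (TensorProduct.lid k A).toLinearMap ∘ₗ TensorProduct.map γ (LinearMap.mul' k A) ∘ₗ
      (TensorProduct.tensorTensorTensorComm k A A A A).toLinearMap ∘ₗ
      TensorProduct.map Coalgebra.comul Coalgebra.comul ∘ₗ
      (TensorProduct.comm k A A).toLinearMap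
  right_mul : γ ∘ₗ (LinearMap.mul' k A).lTensor A =
    LinearMap.mul' k k ∘ₗ TensorProduct.map γ γ ∘ₗ
      (TensorProduct.tensorTensorTensorComm k A A A A).toLinearMap ∘ₗ
      TensorProduct.map Coalgebra.comul (TensorProduct.comm k A A).toLinearMap
  left_mul : γ ∘ₗ (LinearMap.mul' k A).rTensor A =
    LinearMap.mul' k k ∘ₗ TensorProduct.map γ γ ∘ₗ
      (TensorProduct.tensorTensorTensorComm k A A A A).toLinearMap ∘ₗ
      TensorProduct.map LinearMap.id Coalgebra.comul
  invertible : ∃ γ' : A ⊗[k] A →ₗ[k] k,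
    conv γ γ' = LinearMap.mul' k k ∘ₗ TensorProduct.map Coalgebra.counit Coalgebra.counit ∧
    conv γ' γ = LinearMap.mul' k k ∘ₗ TensorProduct.map Coalgebra.counit Coalgebra.counit

/-- The braiding of `A`-comodules given by `γ`:
`x ⊗ y ↦ γ(y₍₋₁₎, x₍₋₁₎) y₍₀₎ ⊗ x₍₀₎`. -/
def braiding (γ : A ⊗[k] A →ₗ[k] k) {X Y : Type*} [AddCommGroup X] [Module k X]
    [AddCommGroup Y] [Module k Y] (ρX : X →ₗ[k] A ⊗[k] X) (ρY : Y →ₗ[k] A ⊗[k] Y) :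
    X ⊗[k] Y →ₗ[k] Y ⊗[k] X :=
  (TensorProduct.lid k (Y ⊗[k] X)).toLinearMap ∘ₗ γ.rTensor (Y ⊗[k] X) ∘ₗ
    (TensorProduct.tensorTensorTensorComm k A Y A X).toLinearMap ∘ₗ TensorProduct.map ρY ρX ∘ₗ
    (TensorProduct.comm k X Y).toLinearMap

/-- `(M, ρ)` with the structure maps `H` is a Hopf monoid in the braided monoidal category of
`A`-comodules: all structure maps are comodule morphisms, and the Hopf axioms hold with respect to
the braiding given by `γ`. -/
structure HopfData.IsHopfComodule (γ : A ⊗[k] A →ₗ[k] k) {M : Type*} [AddCommGroup M] [Module k M]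
    (ρ : M →ₗ[k] A ⊗[k] M) (H : HopfData k M) : Prop where
  isCoaction : IsCoaction ρ
  mul : IsComodHom (coactTensor ρ ρ) ρ H.mul
  unit : IsComodHom (coactUnit k A) ρ H.unit
  comul : IsComodHom ρ (coactTensor ρ ρ) H.comul
  counit : IsComodHom ρ (coactUnit k A) H.counit
  antipode : IsComodHom ρ ρ H.antipode
  isHopfMonoid : H.IsHopfMonoid (braiding γ ρ ρ)

/-- The distributive law `τ : X ⊗ A → A ⊗ X`, `x ⊗ a ↦ x₍₋₁₎ a ⊗ x₍₀₎`. -/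
def tau {X : Type*} [AddCommGroup X] [Module k X] (ρ : X →ₗ[k] A ⊗[k] X) :
    X ⊗[k] A →ₗ[k] A ⊗[k] X :=
  (LinearMap.mul' k A).rTensor X ∘ₗ (TensorProduct.assoc k A A X).symm.toLinearMap ∘ₗ
    (TensorProduct.comm k X A).toLinearMap.lTensor A ∘ₗ
    (TensorProduct.assoc k A X A).toLinearMap ∘ₗ ρ.rTensor A

/-- `c ⊗ a ↦ γ(c₂, S(c₁ a))`. -/
def antipodeForm (γ : A ⊗[k] A →ₗ[k] k) : A ⊗[k] A →ₗ[k] k :=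
  γ ∘ₗ (HopfAlgebra.antipode k ∘ₗ LinearMap.mul' k A).lTensor A ∘ₗ
    (TensorProduct.assoc k A A A).toLinearMap ∘ₗ
    ((TensorProduct.comm k A A).toLinearMap ∘ₗ Coalgebra.comul).rTensor A

/-- `c ⊗ a ↦ γ(c₃, S(c₂ a₂)) S(c₁ a₁)`. -/
def antipodeAux (γ : A ⊗[k] A →ₗ[k] k) : A ⊗[k] A →ₗ[k] A :=
  (TensorProduct.rid k A).toLinearMap ∘ₗ
    TensorProduct.map (HopfAlgebra.antipode k ∘ₗ LinearMap.mul' k A) (antipodeForm γ) ∘ₗ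
    (TensorProduct.tensorTensorTensorComm k A A A A).toLinearMap ∘ₗ
    TensorProduct.map Coalgebra.comul Coalgebra.comul

/-- The semidirect product `H ⋊ A` of a Hopf ring `A` with braiding coelement `γ` and a Hopf monoid
`H` on the `A`-comodule `(M, ρ)`, with underlying module `M ⊗ A`:
* `(h ⊗ a)(h' ⊗ a') = γ(h'₍₋₁₎, a₁) h h'₍₀₎ ⊗ a₂ a'`, via the braiding `A ⊗ M → M ⊗ A`
  (where `A` coacts on itself by comultiplication);
* `δ(h ⊗ a) = h₁ ⊗ h₂₍₋₁₎ a₁ ⊗ h₂₍₀₎ ⊗ a₂`, via `τ : M ⊗ A → A ⊗ M`;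
* `S(h ⊗ a) = γ(h₍₋₁₎, S(h₍₋₂₎ a₂)) S(h₍₀₎) ⊗ S(h₍₋₃₎ a₁)`. -/
def semidirect (γ : A ⊗[k] A →ₗ[k] k) {M : Type*} [AddCommGroup M] [Module k M]
    (ρ : M →ₗ[k] A ⊗[k] M) (H : HopfData k M) : HopfData k (M ⊗[k] A) where
  mul := TensorProduct.map H.mul (LinearMap.mul' k A) ∘ₗ
    middle (braiding γ (Coalgebra.comul : A →ₗ[k] A ⊗[k] A) ρ)
  unit := TensorProduct.map H.unit (Algebra.linearMap k A) ∘ₗ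
    (TensorProduct.lid k k).symm.toLinearMap
  comul := middle (tau ρ) ∘ₗ TensorProduct.map H.comul Coalgebra.comul
  counit := LinearMap.mul' k k ∘ₗ TensorProduct.map H.counit Coalgebra.counit
  antipode := TensorProduct.map H.antipode (antipodeAux γ) ∘ₗ
    (TensorProduct.assoc k M A A).toLinearMap ∘ₗ
    ((TensorProduct.comm k A M).toLinearMap ∘ₗ ρ).rTensor A

/-- The coaction on the direct sum `D ⊕ I` of a comodule `D` and the unit object `I = k`. -/
def coactSum {D : Type*} [AddCommGroup D] [Module k D] (ρ : D →ₗ[k] A ⊗[k] D) :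
    D × k →ₗ[k] A ⊗[k] (D × k) :=
  LinearMap.coprod ((LinearMap.inl k D k).lTensor A ∘ₗ ρ)
    ((LinearMap.inr k D k).lTensor A ∘ₗ coactUnit k A)

/-- The differential Hopf ring structure on `D ⊕ I`: the nonzero components of the multiplication
are `D ⊗ I → D`, `I ⊗ D → D`, `I ⊗ I → I`, those of the comultiplication are their inverses, the
unit and counit are the inclusion and projection of `I`, and the antipode is `-1` on `D` and
`1` on `I`. -/
def sumHopf (k : Type u) [CommRing k] (D : Type*) [AddCommGroup D] [Module k D] :
    HopfData k (D × k) where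
  mul := TensorProduct.lift (LinearMap.mk₂ k
    (fun p q => ((q.2 • p.1 + p.2 • q.1, p.2 * q.2) : D × k))
    (fun p p' q => by ext <;> simp [add_smul, add_mul]; abel)
    (fun c p q => by ext <;> simp [mul_smul, smul_comm c, mul_assoc])
    (fun p q q' => by ext <;> simp [add_smul, mul_add]; abel)
    (fun c p q => by ext <;> simp [mul_smul, smul_comm c, mul_left_comm]))
  unit := LinearMap.inr k D k
  comul := LinearMap.coprod
    ((TensorProduct.mk k (D × k) (D × k)).flip (0, 1) ∘ₗ LinearMap.inl k D k +
      TensorProduct.mk k (D × k) (D × k) (0, 1) ∘ₗ LinearMap.inl k D k)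
    (TensorProduct.mk k (D × k) (D × k) (0, 1) ∘ₗ LinearMap.inr k D k)
  counit := LinearMap.snd k D k
  antipode := LinearMap.prodMap (-LinearMap.id) LinearMap.id

end Semidirect

section Example

variable (k : Type u) [CommRing k]

/-- The coelement `x^i ⊗ x^j ↦ (-1)^(ij)` of `k[x, x⁻¹]`. -/
def gamma : k[T;T⁻¹] ⊗[k] k[T;T⁻¹] →ₗ[k] k :=
  TensorProduct.lift ((AddMonoidAlgebra.basis ℤ k).constr k fun i =>
    (AddMonoidAlgebra.basis ℤ k).constr k fun j => (((i * j).negOnePow : ℤ) : k))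

theorem gamma_T_tmul_T (i j : ℤ) :
    gamma k (T i ⊗ₜ T j) = (((i * j).negOnePow : ℤ) : k) := by
  have h : ∀ n : ℤ, (T n : k[T;T⁻¹]) = AddMonoidAlgebra.basis ℤ k n := by
    intro n; exact (AddMonoidAlgebra.basis_apply k n).symm
  rw [h, h, gamma, TensorProduct.lift.tmul, Module.Basis.constr_basis, Module.Basis.constr_basis]

/-- The coaction `r ↦ x^n ⊗ r` on `k` placed in degree `n`. -/
def coactDegree (n : ℤ) : k →ₗ[k] k[T;T⁻¹] ⊗[k] k :=
  TensorProduct.mk k k[T;T⁻¹] k (T n)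

/-- The coaction of `k[x, x⁻¹]` on `H = D ⊕ k`, with `D = k` in degree `s`. -/
def coactH (s : ℤˣ) : k × k →ₗ[k] k[T;T⁻¹] ⊗[k] (k × k) := coactSum (coactDegree k s)

/-- The underlying module of `(D ⊕ k) ⋊ k[x, x⁻¹]`, with `D = k`. -/
abbrev Q : Type u := (k × k) ⊗[k] k[T;T⁻¹]

/-- The semidirect product `(D ⊕ k) ⋊ k[x, x⁻¹]`, with `D = k` in degree `s`. -/
def semidirectQ (s : ℤˣ) : HopfData k (Q k) := semidirect (gamma k) (coactH k s) (sumHopf k k)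

/-- The element `x^j = 1 ⊗ x^j` of `(D ⊕ k) ⋊ k[x, x⁻¹]`. -/
def Q.x (j : ℤ) : Q k := ((0, 1) : k × k) ⊗ₜ T j

/-- The element `d ⊗ x^j` of `(D ⊕ k) ⋊ k[x, x⁻¹]`, where `d` is the generator of `D`. -/
def Q.dx (j : ℤ) : Q k := ((1, 0) : k × k) ⊗ₜ T j

end Example

section Complexes

/-- The sign `(-1)^i` in the differential `d(a ⊗ b) = da ⊗ b + (-1)^i a ⊗ db`, `a` of degree `i`,
of the tensor product of `ℤ`-indexed chain complexes. -/
instance tensorSignsDownInt : ComplexShape.TensorSigns (ComplexShape.down ℤ) where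
  ε' := MonoidHom.mk' Int.negOnePow Int.negOnePow_add
  rel_add p q r hpq := by simp only [ComplexShape.down_Rel] at *; lia
  add_rel p q r hpq := by simp only [ComplexShape.down_Rel] at *; lia
  ε'_succ p q hpq := by
    simp only [ComplexShape.down_Rel] at hpq
    subst hpq
    change Int.negOnePow q = - Int.negOnePow (q + 1)
    rw [Int.negOnePow_succ, neg_neg]

/-- The functor sending a complex to the direct sum of its components. -/
def totalSum (k : Type u) [CommRing k] (c : ComplexShape ℤ) :
    HomologicalComplex (ModuleCat.{u} k) c ⥤ ModuleCat.{u} k where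
  obj K := ModuleCat.of k (DirectSum ℤ fun n => K.X n)
  map f := ModuleCat.ofHom (DirectSum.lmap fun n => (f.f n).hom)
  map_id K := by
    refine ModuleCat.hom_ext (DirectSum.linearMap_ext k fun n => LinearMap.ext fun a => ?_)
    simp
  map_comp f g := by
    refine ModuleCat.hom_ext (DirectSum.linearMap_ext k fun n => LinearMap.ext fun a => ?_)
    simp [DirectSum.lmap_lof]

/-- The monoidal category of comodules over `Par k s` is that of complexes of shape `c`: there is a
monoidal equivalence whose underlying module is the direct sum of the components, an element `a`
of degree `n` coacting by `a ↦ ξ^n ⊗ a + ψ ξ^(n - s) ⊗ d a`. -/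
def ComodulesAreComplexes (k : Type u) [CommRing k] (s : ℤˣ) (c : ComplexShape ℤ)
    [c.TensorSigns] : Prop :=
  ∃ (F : HomologicalComplex (ModuleCat.{u} k) c ≌ LeftComod k (Par k s))
    (φ : totalSum k c ≅ F.functor ⋙ LeftComod.forget k (Par k s)),
    Nonempty F.functor.Monoidal ∧
    ∀ (K : HomologicalComplex (ModuleCat.{u} k) c) (n : ℤ) (a : K.X n),
      let i : ∀ m : ℤ, K.X m →ₗ[k] (F.functor.obj K).carrier := fun m =>
        (φ.hom.app K).hom ∘ₗ DirectSum.lof k ℤ (fun m => K.X m) m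
      (F.functor.obj K).coact (i n a) =
        ((Par.xi k s ^ n : (Par k s)ˣ) : Par k s) ⊗ₜ i n a +
        (Par.psi k s * ((Par.xi k s ^ (n - s) : (Par k s)ˣ) : Par k s)) ⊗ₜ
          i (n - s) ((K.d n (n - s)).hom a)

end Complexes

end Pareigis

end

open Pareigis

/-! The monomials `x^j` are grouplike, so on them every Sweedler sum has a single term. The axioms
of a braiding coelement then say that `(-1)^(ij)` is multiplicative in each variable and takes
invertible values, together with commutativity of `k[x, x⁻¹]`. The resulting braiding of graded
modules is the Koszul sign rule. Because `s` is odd, `d` braids with itself by `-1`, and this sign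
makes a primitive `d` compatible with `d * d = 0`: the two cross terms of `Δ(d) Δ(d)` cancel.

The semidirect product has the basis `x^j`, `d ⊗ x^j`. Its structure constants show two effects:
moving `x^j` past `d` by the braiding costs `(-1)^j`, and moving `d` past `x^j` by `tau` multiplies
by `x^s`. The Hopf axioms are checked on this basis.

To identify it with `Par k s`, the difficulty is that a quotient of a free algebra might be too
small: `ξ^n` and `ψ ξ^n` must be shown independent. For this `Par k s` acts on the semidirect
product by left multiplication (`Par.rep`), and `p ↦ p · x^0` is inverse to the evident map
`Par.ofQ` (`Par.ofQ_rep`, `Par.equivQ`). This also gives a basis of `Par k s`.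

A coaction of `Par k s` is expanded in that basis. Its coefficients at `ξ^n` are operators `proj n`,
those at `ψ ξ^n` operators `diff n`. Coassociativity says that the `proj n` are orthogonal
idempotents, that `diff n` maps degree `n + s` to degree `n`, and that composites of two `diff`
vanish; the counit axiom says that the `proj n` sum to the identity. This is exactly a complex with
differential of degree `-s` (`full_totalComod`, `LeftComod.totalComodIso`). The equivalence is
monoidal because `ξ^i ψ = (-1)^i ψ ξ^i` produces the sign of the tensor differential and `ψ² = 0`
removes the term `da ⊗ db` (`isComodHom_totalMu`). -/

noncomputable section

namespace Pareigis

/-! ### The sign bicharacter on Laurent polynomials -/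

section LaurentExample

variable {k : Type u} [CommRing k]

theorem laurent_hom_ext {M : Type*} [AddCommMonoid M] [Module k M] {f g : k[T;T⁻¹] →ₗ[k] M}
    (h : ∀ j : ℤ, f (T j) = g (T j)) : f = g :=
  (AddMonoidAlgebra.basis ℤ k).ext fun j => by
    rw [AddMonoidAlgebra.basis_apply]; exact h j

theorem negOnePow_cast_mul_self (n : ℤ) :
    ((n.negOnePow : ℤ) : k) * ((n.negOnePow : ℤ) : k) = 1 := by
  rw [← Int.cast_mul, ← Units.val_mul, Int.units_mul_self]; simp

/-- Convolution of forms is pointwise multiplication on pairs of grouplikes, and the values of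
`gamma` are signs, so `gamma` is its own inverse. -/
theorem conv_gamma_self : conv (gamma k) (gamma k) =
    LinearMap.mul' k k ∘ₗ TensorProduct.map Coalgebra.counit Coalgebra.counit := by
  refine TensorProduct.ext (laurent_hom_ext fun i => laurent_hom_ext fun j => ?_)
  simp only [conv, LinearMap.compr₂ₛₗ_apply, TensorProduct.mk_apply, LinearMap.comp_apply,
    TensorProduct.map_tmul, LaurentPolynomial.comul_T, LinearEquiv.coe_coe,
    TensorProduct.tensorTensorTensorComm_tmul, gamma_T_tmul_T, LinearMap.mul'_apply,
    negOnePow_cast_mul_self, LaurentPolynomial.counit_T, mul_one]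

/-- On monomials the first axiom reduces to commutativity of the ring, since both sides carry the
same scalar; the other two reduce to biadditivity of the exponent `i * j`. -/
theorem isBraidingCoelement_gamma : IsBraidingCoelement (gamma k) where
  mul_comm := by
    refine TensorProduct.ext (laurent_hom_ext fun i => laurent_hom_ext fun j => ?_)
    simp only [LinearMap.compr₂ₛₗ_apply, TensorProduct.mk_apply, LinearMap.comp_apply,
      TensorProduct.map_tmul, LaurentPolynomial.comul_T, LinearEquiv.coe_coe,
      TensorProduct.tensorTensorTensorComm_tmul, gamma_T_tmul_T, LinearMap.mul'_apply,
      TensorProduct.comm_tmul, TensorProduct.rid_tmul, TensorProduct.lid_tmul, ← T_add]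
    rw [add_comm i j]
  right_mul := by
    refine TensorProduct.ext (laurent_hom_ext fun i => TensorProduct.ext
      (laurent_hom_ext fun j => laurent_hom_ext fun l => ?_))
    simp only [LinearMap.compr₂ₛₗ_apply, TensorProduct.mk_apply, LinearMap.comp_apply,
      TensorProduct.map_tmul, LaurentPolynomial.comul_T, LinearEquiv.coe_coe,
      TensorProduct.tensorTensorTensorComm_tmul, gamma_T_tmul_T, LinearMap.mul'_apply,
      LinearMap.lTensor_tmul, TensorProduct.comm_tmul, ← T_add, mul_add, Int.negOnePow_add,
      Units.val_mul, Int.cast_mul]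
    rw [mul_comm]
  left_mul := by
    refine TensorProduct.ext (TensorProduct.ext
      (laurent_hom_ext fun i => laurent_hom_ext fun j => laurent_hom_ext fun l => ?_))
    simp only [LinearMap.compr₂ₛₗ_apply, TensorProduct.mk_apply, LinearMap.comp_apply,
      TensorProduct.map_tmul, LaurentPolynomial.comul_T, LinearEquiv.coe_coe,
      TensorProduct.tensorTensorTensorComm_tmul, gamma_T_tmul_T, LinearMap.mul'_apply,
      LinearMap.rTensor_tmul, ← T_add, add_mul, Int.negOnePow_add, LinearMap.id_apply,
      Units.val_mul, Int.cast_mul]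
  invertible := ⟨gamma k, conv_gamma_self, conv_gamma_self⟩

theorem isCoaction_coactDegree (n : ℤ) : IsCoaction (coactDegree k n) where
  counit := by ext; simp [coactDegree]
  coassoc := by ext; simp [coactDegree]

/-- Oddness of `s` enters through this lemma, the sign of `d` against itself, and the next one, the
sign of `d` against `x^j`. -/
theorem negOnePow_units_mul_self (s : ℤˣ) : ((s : ℤ) * s).negOnePow = -1 := by
  rw [← Units.val_mul, Int.units_mul_self]; simp

theorem negOnePow_units_mul (s : ℤˣ) (j : ℤ) : ((s : ℤ) * j).negOnePow = j.negOnePow := by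
  obtain rfl | rfl := Int.units_eq_one_or s <;> simp

theorem braiding_coactDegree (s : ℤˣ) :
    braiding (gamma k) (coactDegree k s) (coactDegree k s) = -LinearMap.id := by
  ext
  simp [braiding, coactDegree, gamma_T_tmul_T]

end LaurentExample

/-! ### The Hopf monoid `D ⊕ k` in graded modules -/

section SumHopf

variable (k : Type u) [CommRing k]

/-- The generator `d` of `D ⊕ k`, with `D = k d`. -/
def sumD : k × k := (1, 0)

/-- The unit `1` of `D ⊕ k`. -/
def sumOne : k × k := (0, 1)

variable {k} in
theorem sum_hom_ext {M : Type*} [AddCommMonoid M] [Module k M] {f g : k × k →ₗ[k] M}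
    (h₁ : f (sumD k) = g (sumD k)) (h₂ : f (sumOne k) = g (sumOne k)) : f = g := by
  ext
  exacts [h₁, h₂]

theorem sumHopf_mul_D_D : (sumHopf k k).mul (sumD k ⊗ₜ sumD k) = 0 := by
  simp [sumHopf, sumD]

theorem sumHopf_mul_D_one : (sumHopf k k).mul (sumD k ⊗ₜ sumOne k) = sumD k := by
  simp [sumHopf, sumD, sumOne]

theorem sumHopf_mul_one_D : (sumHopf k k).mul (sumOne k ⊗ₜ sumD k) = sumD k := by
  simp [sumHopf, sumD, sumOne]

theorem sumHopf_mul_one_one : (sumHopf k k).mul (sumOne k ⊗ₜ sumOne k) = sumOne k := by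
  simp [sumHopf, sumOne]

theorem sumHopf_unit_one : (sumHopf k k).unit 1 = sumOne k := rfl

theorem sumHopf_comul_D :
    (sumHopf k k).comul (sumD k) = sumD k ⊗ₜ sumOne k + sumOne k ⊗ₜ sumD k := by
  have h : ((0, 0) : k × k) = 0 := rfl
  simp [sumHopf, sumD, sumOne, h]

theorem sumHopf_comul_one : (sumHopf k k).comul (sumOne k) = sumOne k ⊗ₜ sumOne k := by
  have h : ((0, 0) : k × k) = 0 := rfl
  simp [sumHopf, sumOne, h]

theorem sumHopf_counit_D : (sumHopf k k).counit (sumD k) = 0 := rfl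

theorem sumHopf_counit_one : (sumHopf k k).counit (sumOne k) = 1 := rfl

theorem sumHopf_antipode_D : (sumHopf k k).antipode (sumD k) = -sumD k := by
  simp [sumHopf, sumD]

theorem sumHopf_antipode_one : (sumHopf k k).antipode (sumOne k) = sumOne k := by
  simp [sumHopf, sumOne]

theorem coactH_D (s : ℤˣ) : coactH k s (sumD k) = T (s : ℤ) ⊗ₜ sumD k := by
  simp [coactH, coactSum, coactDegree, sumD]

theorem coactH_one (s : ℤˣ) : coactH k s (sumOne k) = 1 ⊗ₜ sumOne k := by
  have h : ((0, 0) : k × k) = 0 := rfl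
  simp [coactH, coactSum, coactDegree, sumOne, h]

/-- The braidings and the map `tau` send pure tensors of basis elements to pure tensors, up to a
scalar that can be absorbed into one factor. This rule therefore evaluates every occurrence of
`middle`. -/
theorem middle_tmul {X Y Z W U V : Type*} [AddCommGroup X] [Module k X] [AddCommGroup Y]
    [Module k Y] [AddCommGroup Z] [Module k Z] [AddCommGroup W] [Module k W] [AddCommGroup U]
    [Module k U] [AddCommGroup V] [Module k V] (f : Y ⊗[k] Z →ₗ[k] U ⊗[k] V)
    {y : Y} {z : Z} {u : U} {v : V} (h : f (y ⊗ₜ z) = u ⊗ₜ v) (x : X) (t : W) :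
    middle f ((x ⊗ₜ y) ⊗ₜ (z ⊗ₜ t)) = (x ⊗ₜ u) ⊗ₜ (v ⊗ₜ t) := by
  simp [middle, h]

/-- Variant for `β(d ⊗ d) = -(d ⊗ d)`: the sign is absorbed into `u` as the scalar `-1` and then
pulled out through the outer map `g`. -/
theorem map_middle_tmul_neg {X Y Z W U V : Type*} [AddCommGroup X] [Module k X] [AddCommGroup Y]
    [Module k Y] [AddCommGroup Z] [Module k Z] [AddCommGroup W] [Module k W] [AddCommGroup U]
    [Module k U] [AddCommGroup V] [Module k V] {N : Type*} [AddCommGroup N] [Module k N]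
    (f : Y ⊗[k] Z →ₗ[k] U ⊗[k] V) (g : (X ⊗[k] U) ⊗[k] (V ⊗[k] W) →ₗ[k] N)
    {y : Y} {z : Z} {u : U} {v : V} (h : f (y ⊗ₜ z) = -(u ⊗ₜ v)) (x : X) (t : W) :
    g (middle f ((x ⊗ₜ y) ⊗ₜ (z ⊗ₜ t))) = -g ((x ⊗ₜ u) ⊗ₜ (v ⊗ₜ t)) := by
  rw [middle_tmul k f (u := (-1 : k) • u) (v := v) (by rw [h, ← smul_tmul', neg_one_smul]),
    tmul_smul, ← smul_tmul', map_smul, neg_one_smul]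

variable {k}

/-- All maps preserve degree, and only compatibility of `Δ` with the product involves the braiding.
There the case of interest is `d ⊗ d`: the cross terms `d ⊗ d` and `β(d ⊗ d) = -(d ⊗ d)` cancel, in
agreement with `Δ(d * d) = 0`. -/
theorem isHopfComodule_sumHopf (s : ℤˣ) :
    (sumHopf k k).IsHopfComodule (gamma k) (coactH k s) := by
  have h11 := gamma_T_tmul_T k 0 0
  have h1s := gamma_T_tmul_T k 0 s
  have hs1 := gamma_T_tmul_T k s 0
  have hss := gamma_T_tmul_T k s s
  simp only [T_zero, mul_zero, zero_mul, Int.negOnePow_zero, Units.val_one, Int.cast_one,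
    negOnePow_units_mul_self, Units.val_neg, Int.cast_neg] at h11 h1s hs1 hss
  have bdd : braiding (gamma k) (coactH k s) (coactH k s) (sumD k ⊗ₜ sumD k) =
      -(sumD k ⊗ₜ sumD k) := by
    simp [braiding, coactH_D, hss, neg_tmul]
  have bd1 : braiding (gamma k) (coactH k s) (coactH k s) (sumD k ⊗ₜ sumOne k) =
      sumOne k ⊗ₜ sumD k := by
    simp [braiding, coactH_D, coactH_one, h1s]
  have b1d : braiding (gamma k) (coactH k s) (coactH k s) (sumOne k ⊗ₜ sumD k) =
      sumD k ⊗ₜ sumOne k := by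
    simp [braiding, coactH_D, coactH_one, hs1]
  have b11 : braiding (gamma k) (coactH k s) (coactH k s) (sumOne k ⊗ₜ sumOne k) =
      sumOne k ⊗ₜ sumOne k := by
    simp [braiding, coactH_one, h11]
  refine ⟨⟨?_, ?_⟩, ?_, ?_, ?_, ?_, ?_, ⟨?_, ?_, ?_, ?_, ?_, ?_, ?_, ?_, ?_, ?_, ?_, ?_⟩⟩
  · refine sum_hom_ext ?_ ?_ <;> simp [coactH_D, coactH_one]
  · refine sum_hom_ext ?_ ?_ <;> simp [coactH_D, coactH_one, Algebra.TensorProduct.one_def]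
  · refine TensorProduct.ext (sum_hom_ext (sum_hom_ext ?_ ?_) (sum_hom_ext ?_ ?_)) <;>
      simp [coactH_D, coactH_one, sumHopf_mul_D_D, sumHopf_mul_D_one, sumHopf_mul_one_D,
        sumHopf_mul_one_one]
  · refine LinearMap.ext_ring ?_
    simp [coactH_one, sumHopf_unit_one]
  · refine sum_hom_ext ?_ ?_ <;>
      simp [coactH_D, coactH_one, sumHopf_comul_D, sumHopf_comul_one, tmul_add]
  · refine sum_hom_ext ?_ ?_ <;> simp [coactH_D, coactH_one, sumHopf_counit_D, sumHopf_counit_one]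
  · refine sum_hom_ext ?_ ?_ <;>
      simp [coactH_D, coactH_one, sumHopf_antipode_D, sumHopf_antipode_one, tmul_neg]
  · refine TensorProduct.ext (TensorProduct.ext (sum_hom_ext
      (sum_hom_ext (sum_hom_ext ?_ ?_) (sum_hom_ext ?_ ?_))
      (sum_hom_ext (sum_hom_ext ?_ ?_) (sum_hom_ext ?_ ?_)))) <;>
      simp [sumHopf_mul_D_D, sumHopf_mul_D_one, sumHopf_mul_one_D, sumHopf_mul_one_one]
  · refine TensorProduct.ext (LinearMap.ext_ring (sum_hom_ext ?_ ?_)) <;>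
      simp [sumHopf_unit_one, sumHopf_mul_one_D, sumHopf_mul_one_one]
  · refine TensorProduct.ext (sum_hom_ext (LinearMap.ext_ring ?_) (LinearMap.ext_ring ?_)) <;>
      simp [sumHopf_unit_one, sumHopf_mul_D_one, sumHopf_mul_one_one]
  · refine sum_hom_ext ?_ ?_ <;>
      simp [sumHopf_comul_D, sumHopf_comul_one, tmul_add, add_tmul, add_assoc]
  · refine sum_hom_ext ?_ ?_ <;>
      simp [sumHopf_comul_D, sumHopf_comul_one, sumHopf_counit_D, sumHopf_counit_one]
  · refine sum_hom_ext ?_ ?_ <;>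
      simp [sumHopf_comul_D, sumHopf_comul_one, sumHopf_counit_D, sumHopf_counit_one]
  · refine LinearMap.ext_ring ?_
    simp [sumHopf_unit_one, sumHopf_counit_one]
  · refine TensorProduct.ext (sum_hom_ext (sum_hom_ext ?_ ?_) (sum_hom_ext ?_ ?_)) <;>
      simp [sumHopf_mul_D_D, sumHopf_mul_D_one, sumHopf_mul_one_D,
        sumHopf_mul_one_one, sumHopf_counit_D, sumHopf_counit_one]
  · refine LinearMap.ext_ring ?_
    simp [sumHopf_unit_one, sumHopf_comul_one]
  · refine TensorProduct.ext (sum_hom_ext (sum_hom_ext ?_ ?_) (sum_hom_ext ?_ ?_)) <;>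
      simp [sumHopf_mul_D_D, sumHopf_mul_D_one, sumHopf_mul_one_D,
        sumHopf_mul_one_one, sumHopf_comul_D, sumHopf_comul_one, tmul_add, add_tmul,
        map_middle_tmul_neg k _ _ bdd, middle_tmul k _ bd1, middle_tmul k _ b1d,
        middle_tmul k _ b11, add_comm]
  · refine sum_hom_ext ?_ ?_ <;>
      simp [sumHopf_comul_D, sumHopf_comul_one, sumHopf_counit_D, sumHopf_counit_one,
        sumHopf_antipode_D, sumHopf_antipode_one, sumHopf_mul_D_one, sumHopf_mul_one_D,
        sumHopf_mul_one_one, sumHopf_unit_one, neg_tmul]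
  · refine sum_hom_ext ?_ ?_ <;>
      simp [sumHopf_comul_D, sumHopf_comul_one, sumHopf_counit_D, sumHopf_counit_one,
        sumHopf_antipode_D, sumHopf_antipode_one, sumHopf_mul_D_one, sumHopf_mul_one_D,
        sumHopf_mul_one_one, sumHopf_unit_one, tmul_neg]

end SumHopf

/-! ### Structure constants and Hopf axioms of the semidirect product -/

section SemidirectQ

variable {k : Type u} [CommRing k] (s : ℤˣ)

theorem Q.x_eq (j : ℤ) : Q.x k j = sumOne k ⊗ₜ T j := rfl

theorem Q.dx_eq (j : ℤ) : Q.dx k j = sumD k ⊗ₜ T j := rfl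

theorem Q.hom_ext {M : Type*} [AddCommMonoid M] [Module k M] {f g : Q k →ₗ[k] M}
    (hx : ∀ j, f (Q.x k j) = g (Q.x k j)) (hd : ∀ j, f (Q.dx k j) = g (Q.dx k j)) : f = g :=
  TensorProduct.ext (sum_hom_ext (laurent_hom_ext hd) (laurent_hom_ext hx))

theorem semidirectQ_counit_dx (j : ℤ) : (semidirectQ k s).counit (Q.dx k j) = 0 := by
  simp [semidirectQ, semidirect, Q.dx_eq, sumHopf_counit_D]

theorem semidirectQ_counit_x (j : ℤ) : (semidirectQ k s).counit (Q.x k j) = 1 := by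
  simp [semidirectQ, semidirect, Q.x_eq, sumHopf_counit_one]

theorem semidirectQ_unit_one : (semidirectQ k s).unit 1 = Q.x k 0 := by
  simp [semidirectQ, semidirect, Q.x_eq, sumHopf_unit_one]

/-- The factor `x^s` split off by the coaction of `d` is what makes `d ⊗ x^0` skew-primitive instead
of primitive. -/
theorem tau_coactH_D (j : ℤ) :
    tau (coactH k s) (sumD k ⊗ₜ T j) = T ((s : ℤ) + j) ⊗ₜ sumD k := by
  simp only [tau, LinearMap.comp_apply, LinearMap.rTensor_tmul, coactH_D, LinearEquiv.coe_coe,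
    TensorProduct.assoc_tmul, LinearMap.lTensor_tmul, TensorProduct.comm_tmul,
    TensorProduct.assoc_symm_tmul, LinearMap.mul'_apply, ← T_add]

theorem tau_coactH_one (j : ℤ) :
    tau (coactH k s) (sumOne k ⊗ₜ T j) = T j ⊗ₜ sumOne k := by
  simp [tau, coactH_one]

theorem semidirectQ_comul_x (j : ℤ) :
    (semidirectQ k s).comul (Q.x k j) = Q.x k j ⊗ₜ Q.x k j := by
  simp [semidirectQ, semidirect, Q.x_eq, sumHopf_comul_one, middle_tmul k _ (tau_coactH_one s j)]

theorem semidirectQ_comul_dx (j : ℤ) : (semidirectQ k s).comul (Q.dx k j) =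
    Q.dx k j ⊗ₜ Q.x k j + Q.x k (s + j) ⊗ₜ Q.dx k j := by
  simp [semidirectQ, semidirect, Q.x_eq, Q.dx_eq, sumHopf_comul_D, add_tmul,
    middle_tmul k _ (tau_coactH_one s j), middle_tmul k _ (tau_coactH_D s j)]

/-- Here `x^j` has degree `j` and `d` has the odd degree `s`, whence the sign `(-1)^(sj) = (-1)^j`.
It becomes the relation `ξψ = -ψξ`. The sign is attached to the left factor so that the right-hand
side is a pure tensor, as `middle_tmul` requires. -/
theorem braiding_T_D (j : ℤ) :
    braiding (gamma k) (Coalgebra.comul : k[T;T⁻¹] →ₗ[k] _) (coactH k s) (T j ⊗ₜ sumD k) =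
      (((j.negOnePow : ℤ) : k) • sumD k) ⊗ₜ T j := by
  simp only [braiding, LinearMap.comp_apply, LinearEquiv.coe_coe, TensorProduct.comm_tmul,
    TensorProduct.map_tmul, coactH_D, LaurentPolynomial.comul_T,
    TensorProduct.tensorTensorTensorComm_tmul, LinearMap.rTensor_tmul, gamma_T_tmul_T,
    TensorProduct.lid_tmul, negOnePow_units_mul, smul_tmul']

theorem braiding_T_one (j : ℤ) :
    braiding (gamma k) (Coalgebra.comul : k[T;T⁻¹] →ₗ[k] _) (coactH k s) (T j ⊗ₜ sumOne k) =
      sumOne k ⊗ₜ T j := by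
  have h := gamma_T_tmul_T k 0 j
  rw [zero_mul, T_zero] at h
  simp [braiding, coactH_one, h]

theorem semidirectQ_mul_dx_dx (j l : ℤ) :
    (semidirectQ k s).mul (Q.dx k j ⊗ₜ Q.dx k l) = 0 := by
  simp only [semidirectQ, semidirect, Q.dx_eq, LinearMap.comp_apply,
    middle_tmul k _ (braiding_T_D s j), TensorProduct.map_tmul, tmul_smul, map_smul,
    sumHopf_mul_D_D, smul_zero, zero_tmul]

theorem semidirectQ_mul_dx_x (j l : ℤ) :
    (semidirectQ k s).mul (Q.dx k j ⊗ₜ Q.x k l) = Q.dx k (j + l) := by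
  simp only [semidirectQ, semidirect, Q.dx_eq, Q.x_eq, LinearMap.comp_apply,
    middle_tmul k _ (braiding_T_one s j), TensorProduct.map_tmul,
    sumHopf_mul_D_one, LinearMap.mul'_apply, ← T_add]

variable (k) in
/-- The sign `(-1)^j` in `k`. -/
def sgn (j : ℤ) : k := ((j.negOnePow : ℤ) : k)

theorem sgn_add (i j : ℤ) : sgn k (i + j) = sgn k i * sgn k j := by
  simp only [sgn, Int.negOnePow_add, Units.val_mul, Int.cast_mul]

theorem sgn_mul_self (j : ℤ) : sgn k j * sgn k j = 1 := negOnePow_cast_mul_self j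

theorem sgn_neg (j : ℤ) : sgn k (-j) = sgn k j := by rw [sgn, Int.negOnePow_neg, sgn]

theorem sgn_zero : sgn k 0 = 1 := by simp [sgn]

theorem sgn_one : sgn k 1 = -1 := by simp [sgn]

theorem sgn_units : sgn k s = -1 := by
  obtain rfl | rfl := Int.units_eq_one_or s <;> simp [sgn]

/-- Computations use signs in `k`, which linear maps and tensor products respect directly; this
translates them into the action of `ℤˣ` used for complexes and in the final statement. -/
theorem sgn_smul {M : Type*} [AddCommGroup M] [Module k M] (j : ℤ) (m : M) :
    sgn k j • m = j.negOnePow • m := by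
  rw [sgn, Int.cast_smul_eq_zsmul]; rfl

theorem semidirectQ_mul_x_dx (j l : ℤ) :
    (semidirectQ k s).mul (Q.x k j ⊗ₜ Q.dx k l) = sgn k j • Q.dx k (j + l) := by
  simp only [semidirectQ, semidirect, Q.dx_eq, Q.x_eq, LinearMap.comp_apply,
    middle_tmul k _ (braiding_T_D s j), TensorProduct.map_tmul, tmul_smul, map_smul,
    sumHopf_mul_one_D, LinearMap.mul'_apply, ← T_add, ← smul_tmul', sgn]

theorem semidirectQ_mul_x_x (j l : ℤ) :
    (semidirectQ k s).mul (Q.x k j ⊗ₜ Q.x k l) = Q.x k (j + l) := by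
  simp only [semidirectQ, semidirect, Q.x_eq, LinearMap.comp_apply,
    middle_tmul k _ (braiding_T_one s j), TensorProduct.map_tmul,
    sumHopf_mul_one_one, LinearMap.mul'_apply, ← T_add]

/-- All three Sweedler components of `x^i` are `x^i`, so the scalar is `γ(x^i, x^(-(i+j)))`; the
minus sign does not affect the parity of the exponent. -/
theorem antipodeAux_gamma (i j : ℤ) : antipodeAux (gamma k) (T i ⊗ₜ T j) =
    (((i * (i + j)).negOnePow : ℤ) : k) • T (-(i + j)) := by
  simp only [antipodeAux, antipodeForm, LinearMap.comp_apply, LinearEquiv.coe_coe,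
    TensorProduct.map_tmul, LaurentPolynomial.comul_T, TensorProduct.comm_tmul,
    TensorProduct.tensorTensorTensorComm_tmul, LinearMap.rTensor_tmul, gamma_T_tmul_T,
    LinearMap.lTensor_tmul, TensorProduct.assoc_tmul, LinearMap.mul'_apply, ← T_add,
    LaurentPolynomial.antipode_T, TensorProduct.rid_tmul, mul_neg, Int.negOnePow_neg]

theorem semidirectQ_antipode_x (j : ℤ) :
    (semidirectQ k s).antipode (Q.x k j) = Q.x k (-j) := by
  have h := antipodeAux_gamma (k := k) 0 j
  rw [T_zero] at h
  simp [semidirectQ, semidirect, Q.x_eq, coactH_one, sumHopf_antipode_one, h]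

theorem semidirectQ_antipode_dx (j : ℤ) :
    (semidirectQ k s).antipode (Q.dx k j) = sgn k j • Q.dx k (-j - s) := by
  have h : -((s : ℤ) + j) = -j - s := by ring
  -- The extra `-1` coming from `s * s` cancels the `-1` of the antipode of `d` in `D ⊕ k`, which
  -- leaves `(-1)^j`.
  have h1 : ((((s : ℤ) * (s + j)).negOnePow : ℤ) : k) = - sgn k j := by
    rw [mul_add, Int.negOnePow_add, negOnePow_units_mul_self, negOnePow_units_mul, neg_one_mul,
      Units.val_neg, Int.cast_neg, sgn]
  simp only [semidirectQ, semidirect, Q.dx_eq, coactH_D, sumHopf_antipode_D, LinearMap.comp_apply,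
    LinearMap.rTensor_tmul, LinearEquiv.coe_coe, TensorProduct.comm_tmul,
    TensorProduct.assoc_tmul, TensorProduct.map_tmul, antipodeAux_gamma, h, h1, tmul_smul]
  rw [← neg_one_smul k (sumD k), ← smul_tmul', smul_smul, mul_neg_one, neg_neg]

/-- With the structure constants at hand each axiom is a check on `x^j` and `d ⊗ x^j`. The cases
where terms must cancel, for products of two elements `d ⊗ x^j` and for the antipode, rest on
`(-1)^(s+j) = -(-1)^j`. -/
theorem isHopfRing_semidirectQ : (semidirectQ k s).IsHopfRing := by
  have hmid : ∀ a b c d : Q k, middle (TensorProduct.comm k (Q k) (Q k)).toLinearMap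
      ((a ⊗ₜ b) ⊗ₜ (c ⊗ₜ d)) = (a ⊗ₜ c) ⊗ₜ (b ⊗ₜ d) :=
    fun a b c d => middle_tmul k _ (by rfl) a d
  refine ⟨?_, ?_, ?_, ?_, ?_, ?_, ?_, ?_, ?_, ?_, ?_, ?_⟩
  · refine TensorProduct.ext (TensorProduct.ext (Q.hom_ext
      (fun i => Q.hom_ext (fun j => Q.hom_ext (fun l => ?_) (fun l => ?_))
        (fun j => Q.hom_ext (fun l => ?_) (fun l => ?_)))
      (fun i => Q.hom_ext (fun j => Q.hom_ext (fun l => ?_) (fun l => ?_))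
        (fun j => Q.hom_ext (fun l => ?_) (fun l => ?_))))) <;>
    simp only [LinearMap.compr₂ₛₗ_apply, TensorProduct.mk_apply, LinearMap.comp_apply,
      LinearMap.rTensor_tmul, LinearMap.lTensor_tmul, LinearEquiv.coe_coe,
      TensorProduct.assoc_tmul, semidirectQ_mul_x_x, semidirectQ_mul_x_dx, semidirectQ_mul_dx_x,
      semidirectQ_mul_dx_dx, tmul_smul, ← smul_tmul', map_smul, tmul_zero, zero_tmul,
      map_zero, smul_zero, add_assoc, smul_smul, sgn_add]
    -- What remains is `x^i x^j (d ⊗ x^l)`, where the two signs arise in opposite orders.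
    rw [mul_comm]
  · refine TensorProduct.ext (LinearMap.ext_ring (Q.hom_ext (fun j => ?_) (fun j => ?_))) <;>
      simp [semidirectQ_unit_one, semidirectQ_mul_x_x, semidirectQ_mul_x_dx, sgn_zero]
  · refine TensorProduct.ext (Q.hom_ext (fun j => LinearMap.ext_ring ?_)
      (fun j => LinearMap.ext_ring ?_)) <;>
      simp [semidirectQ_unit_one, semidirectQ_mul_x_x, semidirectQ_mul_dx_x]
  · refine Q.hom_ext (fun j => ?_) (fun j => ?_) <;>
      simp [semidirectQ_comul_x, semidirectQ_comul_dx, add_tmul, tmul_add, add_assoc]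
  · refine Q.hom_ext (fun j => ?_) (fun j => ?_) <;>
      simp [semidirectQ_comul_x, semidirectQ_comul_dx, semidirectQ_counit_x, semidirectQ_counit_dx]
  · refine Q.hom_ext (fun j => ?_) (fun j => ?_) <;>
      simp [semidirectQ_comul_x, semidirectQ_comul_dx, semidirectQ_counit_x, semidirectQ_counit_dx]
  · refine LinearMap.ext_ring ?_
    simp [semidirectQ_unit_one, semidirectQ_counit_x]
  · refine TensorProduct.ext (Q.hom_ext (fun i => Q.hom_ext (fun j => ?_) (fun j => ?_))
      (fun i => Q.hom_ext (fun j => ?_) (fun j => ?_))) <;>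
      simp [semidirectQ_mul_x_x, semidirectQ_mul_x_dx, semidirectQ_mul_dx_x,
        semidirectQ_mul_dx_dx, semidirectQ_counit_x, semidirectQ_counit_dx]
  · refine LinearMap.ext_ring ?_
    simp [semidirectQ_unit_one, semidirectQ_comul_x]
  · refine TensorProduct.ext (Q.hom_ext (fun i => Q.hom_ext (fun j => ?_) (fun j => ?_))
      (fun i => Q.hom_ext (fun j => ?_) (fun j => ?_))) <;>
      simp only [LinearMap.compr₂ₛₗ_apply, TensorProduct.mk_apply, LinearMap.comp_apply,
        TensorProduct.map_tmul, semidirectQ_mul_x_x, semidirectQ_mul_x_dx, semidirectQ_mul_dx_x,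
        semidirectQ_mul_dx_dx, semidirectQ_comul_x, semidirectQ_comul_dx, map_smul,
        tmul_add, add_tmul, map_add, hmid, smul_add, tmul_smul, ← smul_tmul', tmul_zero, zero_tmul,
        map_zero, add_zero, zero_add, add_left_comm, add_assoc]
    -- What remains is the product of `d ⊗ x^i` and `d ⊗ x^j`: the cross terms are the same tensor
    -- with coefficients `(-1)^(s+i)` and `(-1)^i`.
    rw [← add_smul, sgn_add, sgn_units, neg_one_mul, neg_add_cancel, zero_smul]
  · refine Q.hom_ext (fun j => ?_) (fun j => ?_)
    · simp [semidirectQ_comul_x, semidirectQ_counit_x, semidirectQ_antipode_x,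
        semidirectQ_unit_one, semidirectQ_mul_x_x]
    · have h : -j - (s : ℤ) + j = -(s + j) + j := by ring
      simp [semidirectQ_comul_dx, semidirectQ_counit_dx, semidirectQ_antipode_x,
        semidirectQ_antipode_dx, semidirectQ_mul_x_dx, semidirectQ_mul_dx_x, ← smul_tmul', h,
        sgn_add, sgn_neg, sgn_units, -neg_add_rev]
      rw [← add_smul, add_neg_cancel, zero_smul]
  · refine Q.hom_ext (fun j => ?_) (fun j => ?_)
    · simp [semidirectQ_comul_x, semidirectQ_counit_x, semidirectQ_antipode_x,
        semidirectQ_unit_one, semidirectQ_mul_x_x]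
    · have h : (s : ℤ) + j + (-j - s) = 0 := by ring
      simp [semidirectQ_comul_dx, semidirectQ_counit_dx, semidirectQ_antipode_x,
        semidirectQ_antipode_dx, semidirectQ_mul_x_dx, semidirectQ_mul_dx_x, h,
        sgn_add, sgn_units, smul_smul, sgn_mul_self]

end SemidirectQ

/-! ### The monomials of `Par k s` and its isomorphism with the semidirect product -/

namespace Par

variable {k : Type u} [CommRing k] (s : ℤˣ)

variable (k) in
/-- The basis element `ξ^n` of `Par k s`. -/
def xiPow (n : ℤ) : Par k s := ((xi k s ^ n : (Par k s)ˣ) : Par k s)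

theorem xiPow_zero : xiPow k s 0 = 1 := by simp [xiPow]

theorem xiPow_add (m n : ℤ) : xiPow k s (m + n) = xiPow k s m * xiPow k s n := by
  simp [xiPow, zpow_add]

theorem xiPow_one : xiPow k s 1 = xi k s := by simp [xiPow]

theorem xiPow_neg_one : xiPow k s (-1) = ((xi k s)⁻¹ : (Par k s)ˣ) := by simp [xiPow]

/-- Each factor `ξ` or `ξ⁻¹` that passes `ψ` contributes `-1`; the induction runs in both directions
from `0`. -/
theorem xiPow_mul_psi (n : ℤ) :
    xiPow k s n * psi k s = sgn k n • (psi k s * xiPow k s n) := by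
  induction n using Int.induction_on with
  | zero => simp [xiPow_zero, sgn_zero]
  | succ n ih =>
    rw [xiPow_add, mul_assoc, xiPow_one, xi_mul_psi, mul_neg, ← mul_assoc, ih, sgn_add, sgn_one]
    simp [mul_assoc]
  | pred n ih =>
    rw [sub_eq_add_neg, xiPow_add, mul_assoc, xiPow_neg_one, xiInv_mul_psi, mul_neg, ← mul_assoc,
      ih, sgn_add, sgn_neg (1 : ℤ), sgn_one]
    simp [mul_assoc]

theorem comul_xiPow (n : ℤ) :
    Coalgebra.comul (R := k) (xiPow k s n) = xiPow k s n ⊗ₜ xiPow k s n :=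
  comulHom_xi_zpow k s n

theorem comul_psi_mul_xiPow (n : ℤ) :
    Coalgebra.comul (R := k) (psi k s * xiPow k s n) =
      (psi k s * xiPow k s n) ⊗ₜ xiPow k s n + xiPow k s (s + n) ⊗ₜ (psi k s * xiPow k s n) := by
  rw [Bialgebra.comul_mul, comul_xiPow, comul_eq, comulHom_psi, add_mul,
    Algebra.TensorProduct.tmul_mul_tmul, Algebra.TensorProduct.tmul_mul_tmul, one_mul, xiPow_add]
  rfl

theorem counit_xiPow (n : ℤ) : Coalgebra.counit (R := k) (xiPow k s n) = 1 :=
  counitHom_xi_zpow k s n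

theorem counit_psi_mul_xiPow (n : ℤ) : Coalgebra.counit (R := k) (psi k s * xiPow k s n) = 0 := by
  rw [Bialgebra.counit_mul, counit_psi, zero_mul]

theorem antipode_xiPow (n : ℤ) : HopfAlgebra.antipode k (xiPow k s n) = xiPow k s (-n) :=
  antipodeLin_xi_zpow k s n

theorem antipode_psi_mul_xiPow (n : ℤ) : HopfAlgebra.antipode k (psi k s * xiPow k s n) =
    sgn k n • (psi k s * xiPow k s (-n - s)) := by
  have h : HopfAlgebra.antipode k (psi k s * xiPow k s n) =
      xiPow k s (-n) * (psi k s * xiPow k s (-s)) :=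
    (antipodeLin_mul k s _ _).trans (by rw [antipodeLin_psi, xiPow, antipodeLin_xi_zpow]; rfl)
  rw [h, ← mul_assoc, xiPow_mul_psi, sgn_neg, smul_mul_assoc, mul_assoc, ← xiPow_add,
    sub_eq_add_neg]

/-- Moving `ξ^m` aside brings the two `ψ` together. The trailing factor `y` fits products that are
fully associated to the right. -/
theorem psi_mul_xiPow_mul_psi (m : ℤ) (y : Par k s) :
    psi k s * (xiPow k s m * (psi k s * y)) = 0 := by
  rw [← mul_assoc, ← mul_assoc, mul_assoc (psi k s), xiPow_mul_psi, mul_smul_comm, ← mul_assoc, psi_mul_psi,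
    zero_mul, smul_zero, zero_mul]

/-- The linear map `x^j ↦ ξ^j`, `d ⊗ x^j ↦ ψ ξ^j`. -/
def ofQ : Q k →ₗ[k] Par k s :=
  LinearMap.mul' k (Par k s) ∘ₗ TensorProduct.map
    (LinearMap.coprod (LinearMap.toSpanSingleton k _ (psi k s)) (LinearMap.toSpanSingleton k _ 1))
    ((AddMonoidAlgebra.basis ℤ k).constr k (xiPow k s))

theorem ofQ_x (j : ℤ) : ofQ s (Q.x k j) = xiPow k s j := by
  have h := (AddMonoidAlgebra.basis ℤ k).constr_basis k (xiPow k s) j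
  rw [AddMonoidAlgebra.basis_apply] at h
  change 
    LinearMap.coprod (LinearMap.toSpanSingleton k _ (psi k s)) (LinearMap.toSpanSingleton k _ 1)
      ((0, 1) : k × k) * ((AddMonoidAlgebra.basis ℤ k).constr k (xiPow k s)) (T j) = _
  rw [T, h]; simp

theorem ofQ_dx (j : ℤ) : ofQ s (Q.dx k j) = psi k s * xiPow k s j := by
  have h := (AddMonoidAlgebra.basis ℤ k).constr_basis k (xiPow k s) j
  rw [AddMonoidAlgebra.basis_apply] at h
  change 
    LinearMap.coprod (LinearMap.toSpanSingleton k _ (psi k s)) (LinearMap.toSpanSingleton k _ 1)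
      ((1, 0) : k × k) * ((AddMonoidAlgebra.basis ℤ k).constr k (xiPow k s)) (T j) = _
  rw [T, h]; simp

variable (k) in
/-- Left multiplication by `x^j` on the semidirect product. -/
def lmulX (j : ℤ) : Module.End k (Q k) := TensorProduct.curry (semidirectQ k s).mul (Q.x k j)

variable (k) in
/-- Left multiplication by `d` on the semidirect product. -/
def lmulD : Module.End k (Q k) := TensorProduct.curry (semidirectQ k s).mul (Q.dx k 0)

theorem lmulX_x (i j : ℤ) : lmulX k s i (Q.x k j) = Q.x k (i + j) := semidirectQ_mul_x_x s i j

theorem lmulX_dx (i j : ℤ) : lmulX k s i (Q.dx k j) = sgn k i • Q.dx k (i + j) :=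
  semidirectQ_mul_x_dx s i j

theorem lmulD_x (j : ℤ) : lmulD k s (Q.x k j) = Q.dx k j := by
  exact (semidirectQ_mul_dx_x s 0 j).trans (by rw [zero_add])

theorem lmulD_dx (j : ℤ) : lmulD k s (Q.dx k j) = 0 := semidirectQ_mul_dx_dx s 0 j

/-- Together with `lmulX_zero` this makes `lmulX 1` a unit of the endomorphism ring, as the
universal property of `Par k s` demands of the image of `ξ`. -/
theorem lmulX_mul_lmulX (i j : ℤ) : lmulX k s i * lmulX k s j = lmulX k s (i + j) :=
  Q.hom_ext (fun l => by simp [lmulX_x, add_assoc])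
    (fun l => by simp [lmulX_dx, smul_smul, sgn_add, add_assoc, mul_comm])

theorem lmulX_zero : lmulX k s 0 = 1 :=
  Q.hom_ext (fun l => by simp [lmulX_x]) (fun l => by simp [lmulX_dx, sgn_zero])

/-- The representation of `Par k s` on the semidirect product by left multiplication. -/
def rep : Par k s →ₐ[k] Module.End k (Q k) :=
  lift ⟨lmulX k s 1, lmulX k s (-1), by simp [lmulX_mul_lmulX, lmulX_zero],
      by simp [lmulX_mul_lmulX, lmulX_zero]⟩ (lmulD k s)
    (Q.hom_ext (fun l => by
      simp only [Module.End.mul_apply, LinearMap.neg_apply, lmulX_x, lmulD_x, lmulX_dx, sgn_one]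
      exact neg_one_smul k (Q.dx k (1 + l)))
      (fun l => by simp [lmulD_dx, lmulX_dx]))
    (Q.hom_ext (fun l => by simp [lmulD_x, lmulD_dx]) (fun l => by simp [lmulD_dx]))

theorem rep_xi : rep s (xi k s) = lmulX k s 1 := lift_xi ..

theorem rep_psi : rep s (psi k s) = lmulD k s := lift_psi ..

theorem rep_xiInv : rep s ((xi k s)⁻¹ : (Par k s)ˣ) = lmulX k s (-1) := by
  have h := map_xi_zpow k s (rep s) ⟨lmulX k s 1, lmulX k s (-1),
    by simp [lmulX_mul_lmulX, lmulX_zero], by simp [lmulX_mul_lmulX, lmulX_zero]⟩ (rep_xi s) (-1)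
  simpa using h

/-- Equivariance needs checking only for the generators of `Par k s`. Evaluated at `q = x^0`, which
`ofQ` sends to `1`, it shows that `p ↦ p · x^0` is a right inverse of `ofQ`. -/
theorem ofQ_rep (p : Par k s) (q : Q k) : ofQ s (rep s p q) = p * ofQ s q := by
  induction p using Par.induction generalizing q with
  | hk r => simp [Algebra.algebraMap_eq_smul_one]
  | hxi =>
    rw [rep_xi]
    refine LinearMap.congr_fun (f := ofQ s ∘ₗ lmulX k s 1)
      (g := LinearMap.mulLeft k (xi k s : Par k s) ∘ₗ ofQ s) (Q.hom_ext (fun j => ?_)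
        (fun j => ?_)) q
    · simp [lmulX_x, ofQ_x, xiPow_add, xiPow_one]
    · simp [lmulX_dx, ofQ_dx, xiPow_add, xiPow_one, sgn_one, ← mul_assoc, xi_mul_psi]
  | hxiInv =>
    rw [rep_xiInv]
    refine LinearMap.congr_fun (f := ofQ s ∘ₗ lmulX k s (-1))
      (g := LinearMap.mulLeft k (((xi k s)⁻¹ : (Par k s)ˣ) : Par k s) ∘ₗ ofQ s)
      (Q.hom_ext (fun j => ?_) (fun j => ?_)) q
    · simp [lmulX_x, ofQ_x, xiPow_add, xiPow_neg_one]
    · simp [lmulX_dx, ofQ_dx, xiPow_add, xiPow_neg_one, sgn_neg, sgn_one, ← mul_assoc,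
        xiInv_mul_psi]
  | hpsi =>
    rw [rep_psi]
    refine LinearMap.congr_fun (f := ofQ s ∘ₗ lmulD k s)
      (g := LinearMap.mulLeft k (psi k s) ∘ₗ ofQ s) (Q.hom_ext (fun j => ?_) (fun j => ?_)) q
    · simp [lmulD_x, ofQ_x, ofQ_dx]
    · simp [lmulD_dx, ofQ_dx, ← mul_assoc, psi_mul_psi]
  | hadd a b ha hb => simp [ha, hb, add_mul]
  | hmul a b ha hb => simp [ha, hb, mul_assoc]

theorem rep_xiPow_x (n j : ℤ) : rep s (xiPow k s n) (Q.x k j) = Q.x k (n + j) := by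
  induction n using Int.induction_on generalizing j with
  | zero => simp [xiPow_zero]
  | succ n ih => rw [xiPow_add, xiPow_one, map_mul, rep_xi, Module.End.mul_apply, lmulX_x, ih,
      add_assoc]
  | pred n ih => rw [sub_eq_add_neg, xiPow_add, xiPow_neg_one, map_mul, rep_xiInv,
      Module.End.mul_apply, lmulX_x, ih, add_assoc]

variable (k) in
/-- The semidirect product is isomorphic to `Par k s` as a module. -/
def equivQ : Q k ≃ₗ[k] Par k s :=
  LinearEquiv.ofLinearMap (ofQ s) (LinearMap.applyₗ (Q.x k 0) ∘ₗ (rep s).toLinearMap)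
    -- The first identity is equivariance at `x^0`. The second, that `ξ^j` and `ψ ξ^j` act on `x^0`
    -- to give back `x^j` and `d ⊗ x^j`, is the one that proves the monomials independent.
    (LinearMap.ext fun p => by simp [ofQ_rep, ofQ_x, xiPow_zero])
    (Q.hom_ext (fun j => by simp [ofQ_x, rep_xiPow_x])
      (fun j => by simp [ofQ_dx, rep_xiPow_x, rep_psi, lmulD_x]))

theorem equivQ_x (j : ℤ) : equivQ k s (Q.x k j) = xiPow k s j := ofQ_x s j

theorem equivQ_dx (j : ℤ) : equivQ k s (Q.dx k j) = psi k s * xiPow k s j := ofQ_dx s j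

variable (k) in
/-- The isomorphism of Hopf rings between the semidirect product and `Par k s`. -/
def hopfIsoQ : HopfIso (semidirectQ k s) (HopfData.of k (Par k s)) where
  toLinearEquiv := equivQ k s
  map_mul := by
    refine TensorProduct.ext (Q.hom_ext (fun i => Q.hom_ext (fun j => ?_) (fun j => ?_))
      (fun i => Q.hom_ext (fun j => ?_) (fun j => ?_))) <;>
      simp [HopfData.of, semidirectQ_mul_x_x, semidirectQ_mul_x_dx, semidirectQ_mul_dx_x,
        semidirectQ_mul_dx_dx, equivQ_x, equivQ_dx, xiPow_add, psi_mul_xiPow_mul_psi, mul_assoc]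
    rw [← mul_assoc (xiPow k s i) (psi k s), xiPow_mul_psi, smul_mul_assoc, mul_assoc]
  map_unit := by
    refine LinearMap.ext_ring ?_
    simp [HopfData.of, semidirectQ_unit_one, equivQ_x, xiPow_zero]
  map_comul := by
    refine Q.hom_ext (fun j => ?_) (fun j => ?_) <;>
      simp [HopfData.of, semidirectQ_comul_x, semidirectQ_comul_dx, equivQ_x, equivQ_dx,
        comul_xiPow, comul_psi_mul_xiPow, -Bialgebra.comul_mul]
  map_counit := by
    refine Q.hom_ext (fun j => ?_) (fun j => ?_) <;>
      simp [HopfData.of, semidirectQ_counit_x, semidirectQ_counit_dx, equivQ_x, equivQ_dx,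
        counit_xiPow, counit_psi]
  map_antipode := by
    refine Q.hom_ext (fun j => ?_) (fun j => ?_) <;>
      simp [HopfData.of, semidirectQ_antipode_x, semidirectQ_antipode_dx, equivQ_x, equivQ_dx,
        antipode_xiPow, antipode_psi_mul_xiPow]

/-! ### The isomorphism exchanging `ξ` and `ξ⁻¹` -/

variable {s} in
/-- For `s = -t`, the algebra homomorphism `ξ ↦ ξ⁻¹`, `ψ ↦ ψ`. -/
def flip (s t : ℤˣ) : Par k s →ₐ[k] Par k t :=
  lift (xi k t)⁻¹ (psi k t) xiInv_mul_psi (psi_mul_psi k t)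

theorem flip_xi (t : ℤˣ) : flip s t (xi k s : Par k s) = ((xi k t)⁻¹ : (Par k t)ˣ) := lift_xi ..

theorem flip_psi (t : ℤˣ) : flip s t (psi k s) = psi k t := lift_psi ..

theorem flip_xiPow (t : ℤˣ) (n : ℤ) : flip s t (xiPow k s n) = xiPow k t (-n) := by
  rw [xiPow, map_xi_zpow k s (flip s t) (xi k t)⁻¹ (flip_xi s t), inv_zpow', xiPow]

theorem flip_comp_flip (t : ℤˣ) : (flip t s).comp (flip s t) = AlgHom.id k (Par k s) := by
  refine algHom_ext ?_ ?_
  · have := flip_xiPow (k := k) t s (-1)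
    rw [xiPow_neg_one, neg_neg, xiPow_one] at this
    simp [flip_xi, this]
  · simp [flip_psi]

/-- The map carries `ξ^s` to `ξ^(-s) = ξ^t`, hence the coproduct of `ψ` for `s` to that for `t`.
Both sides are algebra homomorphisms, so the generators suffice. -/
theorem comul_flip {t : ℤˣ} (h : (t : ℤ) = -s) : (comulHom k t).comp (flip s t) =
    (Algebra.TensorProduct.map (flip s t) (flip s t)).comp (comulHom k s) := by
  have h1 := flip_xiPow (k := k) s t s
  rw [xiPow, ← h, xiPow] at h1
  refine algHom_ext ?_ ?_
  · have := comulHom_xi_zpow k t (-1)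
    rw [zpow_neg_one] at this
    simp [flip_xi, this]
  · simp [flip_psi, h1]

theorem counit_flip (t : ℤˣ) : (counitHom k t).comp (flip s t) = counitHom k s := by
  refine algHom_ext ?_ ?_
  · have := counitHom_xi_zpow k t (-1)
    rw [zpow_neg_one] at this
    simp [flip_xi, this]
  · simp [flip_psi]

/-- Antipodes reverse products; viewed as homomorphisms to the opposite algebra they too can be
compared on generators alone. -/
theorem antipode_flip {t : ℤˣ} (h : (t : ℤ) = -s) : (antipodeHom k t).comp (flip s t) =
    (AlgHom.op (flip s t)).comp (antipodeHom k s) := by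
  refine algHom_ext ?_ ?_
  · refine MulOpposite.unop_injective ?_
    have h1 := antipodeLin_xi_zpow k t (-1)
    have h2 := antipodeLin_xi k s
    have h3 := flip_xiPow (k := k) s t (-1)
    rw [zpow_neg_one, neg_neg, zpow_one] at h1
    rw [xiPow_neg_one, neg_neg, xiPow_one] at h3
    simp only [antipodeLin, LinearMap.comp_apply, LinearEquiv.coe_coe, AlgHom.toLinearMap_apply,
      MulOpposite.coe_opLinearEquiv_symm] at h1 h2
    simp [flip_xi, h1, h2, h3]
  · refine MulOpposite.unop_injective ?_
    have h1 := antipodeLin_psi k t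
    have h2 := antipodeLin_psi k s
    have h3 := flip_xiPow (k := k) s t (-s)
    rw [← h, xiPow, xiPow] at h3
    simp only [antipodeLin, LinearMap.comp_apply, LinearEquiv.coe_coe, AlgHom.toLinearMap_apply,
      MulOpposite.coe_opLinearEquiv_symm] at h1 h2
    simp [flip_psi, h1, h2, h3, ← h]

variable (k) in
/-- For `s = -t`, the isomorphism of Hopf rings `ξ ↦ ξ⁻¹`, `ψ ↦ ψ`. -/
def flipIso {s t : ℤˣ} (h : (t : ℤ) = -s) :
    HopfIso (HopfData.of k (Par k s)) (HopfData.of k (Par k t)) where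
  toLinearEquiv := (AlgEquiv.ofAlgHom (flip s t) (flip t s) (flip_comp_flip t s)
    (flip_comp_flip s t)).toLinearEquiv
  map_mul := TensorProduct.ext' fun a b => map_mul (flip s t) a b
  map_unit := LinearMap.ext_ring (by simp [HopfData.of])
  map_comul := LinearMap.ext fun a => DFunLike.congr_fun (comul_flip s h) a
  map_counit := LinearMap.ext fun a => DFunLike.congr_fun (counit_flip s t) a
  map_antipode := LinearMap.ext fun a =>
    congrArg MulOpposite.unop (DFunLike.congr_fun (antipode_flip s h) a)

variable (k) in
/-- The basis of `Par k s` consisting of `ψ ξ^n` (indexed by `(0, n)`) and `ξ^n`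
(indexed by `(1, n)`). -/
def basis : Module.Basis (Fin 2 × ℤ) k (Par k s) :=
  ((Module.Basis.finTwoProd k).tensorProduct (AddMonoidAlgebra.basis ℤ k)).map (equivQ k s)

theorem basis_zero (n : ℤ) : basis k s (0, n) = psi k s * xiPow k s n := by
  rw [← equivQ_dx, basis, Module.Basis.map_apply, Module.Basis.tensorProduct_apply,
    Module.Basis.finTwoProd_zero, AddMonoidAlgebra.basis_apply]
  rfl

theorem basis_one (n : ℤ) : basis k s (1, n) = xiPow k s n := by
  rw [← equivQ_x, basis, Module.Basis.map_apply, Module.Basis.tensorProduct_apply,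
    Module.Basis.finTwoProd_one, AddMonoidAlgebra.basis_apply]
  rfl

end Par

/-! ### Coefficients in the monomial basis and the coproduct -/

section Coefficients

variable {k : Type u} [CommRing k] {s : ℤˣ} {X Y : Type*} [AddCommGroup X] [Module k X]
  [AddCommGroup Y] [Module k Y]

namespace Par

variable (k s X) in
/-- The coefficient of a basis element in an element of `Par k s ⊗ X`. -/
def coef (i : Fin 2 × ℤ) : Par k s ⊗[k] X →ₗ[k] X :=
  (TensorProduct.lid k X).toLinearMap ∘ₗ ((basis k s).coord i).rTensor X

theorem coef_basis_tmul (i j : Fin 2 × ℤ) (x : X) :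
    coef k s X i (basis k s j ⊗ₜ x) = if j = i then x else 0 := by
  simp [coef, Finsupp.single_apply]

theorem coef_one_xiPow (m n : ℤ) (x : X) :
    coef k s X (1, m) (xiPow k s n ⊗ₜ x) = if n = m then x else 0 := by
  rw [← basis_one, coef_basis_tmul]; simp

theorem coef_zero_xiPow (m n : ℤ) (x : X) :
    coef k s X (0, m) (xiPow k s n ⊗ₜ x) = 0 := by
  rw [← basis_one, coef_basis_tmul]; simp

theorem coef_one_psi (m n : ℤ) (x : X) :
    coef k s X (1, m) ((psi k s * xiPow k s n) ⊗ₜ x) = 0 := by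
  rw [← basis_zero, coef_basis_tmul]; simp

theorem coef_zero_psi (m n : ℤ) (x : X) :
    coef k s X (0, m) ((psi k s * xiPow k s n) ⊗ₜ x) = if n = m then x else 0 := by
  rw [← basis_zero, coef_basis_tmul]; simp

theorem tensor_ext {t t' : Par k s ⊗[k] X}
    (h₁ : ∀ n, coef k s X (1, n) t = coef k s X (1, n) t')
    (h₀ : ∀ n, coef k s X (0, n) t = coef k s X (0, n) t') : t = t' := by
  refine (TensorProduct.equivFinsuppOfBasisLeft (basis k s)).injective (Finsupp.ext ?_)
  rintro ⟨i, n⟩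
  rw [TensorProduct.equivFinsuppOfBasisLeft_apply, TensorProduct.equivFinsuppOfBasisLeft_apply]
  fin_cases i
  exacts [h₀ n, h₁ n]

theorem tensor_hom_ext {M : Type*} [AddCommMonoid M] [Module k M]
    {f g : Par k s ⊗[k] X →ₗ[k] M}
    (h₁ : ∀ n x, f (xiPow k s n ⊗ₜ x) = g (xiPow k s n ⊗ₜ x))
    (h₀ : ∀ n x, f ((psi k s * xiPow k s n) ⊗ₜ x) = g ((psi k s * xiPow k s n) ⊗ₜ x)) :
    f = g := by
  refine TensorProduct.ext ((basis k s).ext ?_)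
  rintro ⟨i, n⟩
  fin_cases i
  · exact LinearMap.ext fun x => by simpa [basis_zero] using h₀ n x
  · exact LinearMap.ext fun x => by simpa [basis_one] using h₁ n x

theorem coef_lTensor (f : X →ₗ[k] Y) (i : Fin 2 × ℤ) (t : Par k s ⊗[k] X) :
    coef k s Y i (f.lTensor _ t) = f (coef k s X i t) := by
  induction t with
  | zero => simp
  | add a b ha hb => simp [ha, hb]
  | tmul p x => simp [coef]

/-- The map `(Δ ⊗ 1) : Par ⊗ X → Par ⊗ (Par ⊗ X)`. -/
def comulTensor : Par k s ⊗[k] X →ₗ[k] Par k s ⊗[k] (Par k s ⊗[k] X) :=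
  (TensorProduct.assoc k _ _ X).toLinearMap ∘ₗ
    (Coalgebra.comul (R := k) (A := Par k s)).rTensor X

theorem comulTensor_xiPow (n : ℤ) (x : X) :
    comulTensor (xiPow k s n ⊗ₜ x) = xiPow k s n ⊗ₜ (xiPow k s n ⊗ₜ x) := by
  simp [comulTensor, comul_xiPow]

theorem comulTensor_psi (n : ℤ) (x : X) :
    comulTensor ((psi k s * xiPow k s n) ⊗ₜ x) =
      (psi k s * xiPow k s n) ⊗ₜ (xiPow k s n ⊗ₜ x) +
        xiPow k s (s + n) ⊗ₜ ((psi k s * xiPow k s n) ⊗ₜ x) := by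
  simp only [comulTensor, LinearMap.comp_apply, LinearMap.rTensor_tmul, comul_psi_mul_xiPow,
    add_tmul, map_add, LinearEquiv.coe_coe, TensorProduct.assoc_tmul]

/-- This and the next three lemmas form the multiplication table of the coefficient functionals
under convolution. The inner `coef` reads the first tensor factor of the coproduct, the outer one
the second: `Δ(ξ^l)` contributes only `ξ^l ⊗ ξ^l`, and `Δ(ψ ξ^l)` only `ψ ξ^l ⊗ ξ^l` and `ξ^(s+l) ⊗
ψ ξ^l`. -/
theorem coef_one_one_comul (m n : ℤ) (t : Par k s ⊗[k] X) :
    coef k s X (1, m) (coef k s _ (1, n) (comulTensor t)) =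
      if n = m then coef k s X (1, n) t else 0 := by
  refine LinearMap.congr_fun (f := coef k s X (1, m) ∘ₗ coef k s _ (1, n) ∘ₗ comulTensor)
    (g := if n = m then coef k s X (1, n) else 0) (tensor_hom_ext (fun l x => ?_)
      (fun l x => ?_)) t |>.trans (by split_ifs <;> rfl)
  · by_cases hl : l = n <;> by_cases hn : n = m <;> subst_vars <;>
      simp_all [comulTensor_xiPow, coef_one_xiPow]
  · by_cases hl : s + l = n <;> by_cases hn : n = m <;> subst_vars <;>
      simp_all [comulTensor_psi, coef_one_xiPow, coef_one_psi]

/-- The shift by `s` comes from the term `ξ^(s+m) ⊗ ψ ξ^m`; it later becomes the degree of the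
differential. -/
theorem coef_zero_one_comul (m n : ℤ) (t : Par k s ⊗[k] X) :
    coef k s X (0, m) (coef k s _ (1, n) (comulTensor t)) =
      if n = s + m then coef k s X (0, m) t else 0 := by
  refine LinearMap.congr_fun (f := coef k s X (0, m) ∘ₗ coef k s _ (1, n) ∘ₗ comulTensor)
    (g := if n = s + m then coef k s X (0, m) else 0) (tensor_hom_ext (fun l x => ?_)
      (fun l x => ?_)) t |>.trans (by split_ifs <;> rfl)
  · by_cases hl : l = n <;> by_cases hn : n = s + m <;>
      simp_all [comulTensor_xiPow, coef_one_xiPow, coef_zero_xiPow]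
  · by_cases hl : s + l = n
    · by_cases hn : l = m
      · subst_vars; simp [comulTensor_psi, coef_one_xiPow, coef_one_psi, coef_zero_psi]
      · subst hl; simp [comulTensor_psi, coef_one_xiPow, coef_one_psi, coef_zero_psi, hn]
    · by_cases hn : n = s + m
      · have : l ≠ m := by rintro rfl; exact hl hn.symm
        simp [comulTensor_psi, coef_one_xiPow, coef_one_psi, coef_zero_psi, hn, this]
      · simp [comulTensor_psi, coef_one_xiPow, coef_one_psi, hn, hl]

theorem coef_one_zero_comul (m n : ℤ) (t : Par k s ⊗[k] X) :
    coef k s X (1, m) (coef k s _ (0, n) (comulTensor t)) =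
      if n = m then coef k s X (0, n) t else 0 := by
  refine LinearMap.congr_fun (f := coef k s X (1, m) ∘ₗ coef k s _ (0, n) ∘ₗ comulTensor)
    (g := if n = m then coef k s X (0, n) else 0) (tensor_hom_ext (fun l x => ?_)
      (fun l x => ?_)) t |>.trans (by split_ifs <;> rfl)
  · by_cases hn : n = m <;> simp [comulTensor_xiPow, coef_zero_xiPow, hn]
  · by_cases hl : l = n <;> by_cases hn : n = m <;> subst_vars <;>
      simp_all [comulTensor_psi, coef_zero_xiPow, coef_zero_psi, coef_one_xiPow]

theorem coef_zero_zero_comul (m n : ℤ) (t : Par k s ⊗[k] X) :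
    coef k s X (0, m) (coef k s _ (0, n) (comulTensor t)) = 0 := by
  refine LinearMap.congr_fun (f := coef k s X (0, m) ∘ₗ coef k s _ (0, n) ∘ₗ comulTensor)
    (g := 0) (tensor_hom_ext (fun l x => ?_) (fun l x => ?_)) t
  · simp [comulTensor_xiPow, coef_zero_xiPow]
  · by_cases hl : l = n <;>
      simp [comulTensor_psi, coef_zero_xiPow, coef_zero_psi, hl]

/-- Coassociativity turns composites of coefficient operators of a coaction into coefficients of
`Δ`, so the table above becomes a list of relations between operators. -/
theorem coef_coef_coact {ρ : X →ₗ[k] Par k s ⊗[k] X} (hρ : IsCoaction ρ) (i j : Fin 2 × ℤ) (x : X) :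
    coef k s X j (ρ (coef k s X i (ρ x))) =
      coef k s X j (coef k s _ i (comulTensor (ρ x))) := by
  rw [← coef_lTensor ρ]
  exact congrArg (fun t => coef k s X j (coef k s _ i t)) (LinearMap.congr_fun hρ.coassoc x).symm

/-- The counit is `1` on `ξ^n` and `0` on `ψ ξ^n`, so its value on `t` is the finite sum of the
`ξ^n`-coefficients of `t`. Phrasing this as membership in a submodule avoids naming the sum. -/
theorem counit_mem (t : Par k s ⊗[k] X) (N : Submodule k X)
    (h : ∀ n, coef k s X (1, n) t ∈ N) :
    TensorProduct.lid k X ((Coalgebra.counit (R := k) (A := Par k s)).rTensor X t) ∈ N := by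
  have ht := (TensorProduct.equivFinsuppOfBasisLeft (basis k s)).symm_apply_apply t
  rw [TensorProduct.equivFinsuppOfBasisLeft_symm_apply] at ht
  rw [← ht, map_finsuppSum, map_finsuppSum]
  refine Submodule.sum_mem _ fun i _ => ?_
  dsimp only
  rw [TensorProduct.equivFinsuppOfBasisLeft_apply, LinearMap.rTensor_tmul,
    TensorProduct.lid_tmul]
  obtain ⟨i, n⟩ := i
  fin_cases i
  · have : Coalgebra.counit (R := k) (basis k s (0, n)) = 0 := by
      rw [basis_zero, counit_psi_mul_xiPow]
    simp [this]
  · have : Coalgebra.counit (R := k) (basis k s (1, n)) = 1 := by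
      rw [basis_one, counit_xiPow]
    have h2 := h n
    rw [coef, LinearMap.comp_apply, LinearEquiv.coe_coe] at h2
    simpa [this] using h2

end Par

end Coefficients

/-! ### From complexes to comodules: a fully faithful functor -/

section TotalComodule

open Par

variable {k : Type u} [CommRing k] (s : ℤˣ) {c : ComplexShape ℤ}

/-- The coaction `a ↦ ξ^n ⊗ a + ψ ξ^(n - s) ⊗ d a`, `a` of degree `n`, on the direct sum of the
components of a complex. -/
def totalCoact (K : HomologicalComplex (ModuleCat.{u} k) c) :
    (DirectSum ℤ fun n => K.X n) →ₗ[k] Par k s ⊗[k] (DirectSum ℤ fun n => K.X n) :=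
  DirectSum.toModule k ℤ _ fun n =>
    TensorProduct.mk k _ _ (xiPow k s n) ∘ₗ DirectSum.lof k ℤ (fun n => K.X n) n +
    TensorProduct.mk k _ _ (psi k s * xiPow k s (n - s)) ∘ₗ
      DirectSum.lof k ℤ (fun n => K.X n) (n - s) ∘ₗ (K.d n (n - s)).hom

theorem totalCoact_lof (K : HomologicalComplex (ModuleCat.{u} k) c) (n : ℤ) (a : K.X n) :
    totalCoact s K (DirectSum.lof k ℤ (fun n => K.X n) n a) =
      xiPow k s n ⊗ₜ DirectSum.lof k ℤ (fun n => K.X n) n a +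
      (psi k s * xiPow k s (n - s)) ⊗ₜ
        DirectSum.lof k ℤ (fun n => K.X n) (n - s) ((K.d n (n - s)).hom a) := by
  simp [totalCoact]

theorem d_hom_d_hom (K : HomologicalComplex (ModuleCat.{u} k) c) (i j l : ℤ) (a : K.X i) :
    (K.d j l).hom ((K.d i j).hom a) = 0 := by
  rw [← LinearMap.comp_apply, ← ModuleCat.hom_comp, K.d_comp_d]; rfl

/-- Coassociativity holds because `d ∘ d = 0` removes the `ψ ⊗ ψ` term and the factor `ξ^(s + (n -
s))` in the coproduct of `ψ ξ^(n - s)` is `ξ^n`. -/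
theorem isCoaction_totalCoact (K : HomologicalComplex (ModuleCat.{u} k) c) :
    IsCoaction (totalCoact s K) where
  counit := by
    refine DirectSum.linearMap_ext k fun n => LinearMap.ext fun a => ?_
    simp only [LinearMap.comp_apply, totalCoact_lof, map_add, LinearMap.rTensor_tmul,
      counit_xiPow, counit_psi_mul_xiPow, LinearEquiv.coe_coe, TensorProduct.lid_tmul, one_smul,
      zero_smul, add_zero, LinearMap.id_apply]
  coassoc := by
    refine DirectSum.linearMap_ext k fun n => LinearMap.ext fun a => ?_
    have h (t) : TensorProduct.assoc k _ _ _ ((Coalgebra.comul (R := k) (A := Par k s)).rTensor _ t)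
      = comulTensor (X := DirectSum ℤ fun n => K.X n) t := rfl
    simp only [LinearMap.comp_apply, LinearEquiv.coe_coe, h]
    rw [totalCoact_lof, map_add, comulTensor_xiPow, comulTensor_psi, map_add,
      LinearMap.lTensor_tmul, LinearMap.lTensor_tmul, totalCoact_lof, totalCoact_lof,
      d_hom_d_hom, map_zero, tmul_zero, add_zero, tmul_add, add_sub_cancel, add_right_comm,
      add_assoc]

/-- The comodule over `Par k s` on the direct sum of the components of a complex. -/
def totalComod : HomologicalComplex (ModuleCat.{u} k) c ⥤ LeftComod k (Par k s) where
  obj K := ⟨ModuleCat.of k (DirectSum ℤ fun n => K.X n), totalCoact s K, isCoaction_totalCoact s K⟩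
  map {K L} f := ⟨ModuleCat.ofHom (DirectSum.lmap fun n => (f.f n).hom), by
    refine DirectSum.linearMap_ext k fun n => LinearMap.ext fun a => ?_
    have h : (L.d n (n - s)).hom ((f.f n).hom a) = (f.f (n - s)).hom ((K.d n (n - s)).hom a) := by
      rw [← LinearMap.comp_apply, ← LinearMap.comp_apply, ← ModuleCat.hom_comp,
        ← ModuleCat.hom_comp, f.comm]
    simp only [LinearMap.comp_apply, ModuleCat.hom_ofHom, DirectSum.lmap_lof, totalCoact_lof,
      map_add, LinearMap.lTensor_tmul, h]⟩
  map_id K := LeftComod.hom_ext ((totalSum k c).map_id K)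
  map_comp f g := LeftComod.hom_ext ((totalSum k c).map_comp f g)

theorem lof_apply_of_ne {M : ℤ → Type*} [∀ n, AddCommGroup (M n)] [∀ n, Module k (M n)] {m n : ℤ}
    (h : m ≠ n) (a : M n) : DirectSum.lof k ℤ M n a m = 0 :=
  DirectSum.of_eq_of_ne _ _ _ h

/-- The grading, and by the next lemma the differential, can be read off from the coaction. This is
the source of fullness. -/
theorem coef_one_totalCoact (K : HomologicalComplex (ModuleCat.{u} k) c) (m : ℤ)
    (y : DirectSum ℤ fun n => K.X n) :
    coef k s _ (1, m) (totalCoact s K y) = DirectSum.lof k ℤ (fun n => K.X n) m (y m) := by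
  induction y using DirectSum.induction_on with
  | zero => simp
  | add a b ha hb => simp [ha, hb]
  | of n a =>
    change coef k s _ (1, m) (totalCoact s K (DirectSum.lof k ℤ (fun n => K.X n) n a)) = 
      DirectSum.lof k ℤ (fun n => K.X n) m (DirectSum.lof k ℤ (fun n => K.X n) n a m)
    rw [totalCoact_lof, map_add, coef_one_xiPow, coef_one_psi, add_zero]
    split_ifs with h
    · subst h; rw [DirectSum.lof_apply]
    · rw [lof_apply_of_ne (Ne.symm h), map_zero]

theorem coef_zero_totalCoact (K : HomologicalComplex (ModuleCat.{u} k) c) (m : ℤ)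
    (y : DirectSum ℤ fun n => K.X n) :
    coef k s _ (0, m - s) (totalCoact s K y) =
      DirectSum.lof k ℤ (fun n => K.X n) (m - s) ((K.d m (m - s)).hom (y m)) := by
  induction y using DirectSum.induction_on with
  | zero => simp
  | add a b ha hb => simp [ha, hb]
  | of n a =>
    change coef k s _ (0, m - s) (totalCoact s K (DirectSum.lof k ℤ (fun n => K.X n) n a)) = 
      DirectSum.lof k ℤ (fun n => K.X n) (m - s)
        ((K.d m (m - s)).hom (DirectSum.lof k ℤ (fun n => K.X n) n a m))
    rw [totalCoact_lof, map_add, coef_zero_xiPow, coef_zero_psi, zero_add]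
    by_cases h : n = m
    · subst h; rw [DirectSum.lof_apply, if_pos rfl]
    · rw [lof_apply_of_ne (Ne.symm h), map_zero, map_zero, if_neg (by omega)]

instance : (totalComod (k := k) (c := c) s).Faithful where
  map_injective {K L f g} h := by
    refine HomologicalComplex.hom_ext _ _ fun n => ModuleCat.hom_ext (LinearMap.ext fun a => ?_)
    have h1 := LinearMap.congr_fun (congrArg (fun f => ModuleCat.Hom.hom (LeftComod.Hom.hom f)) h)
      (DirectSum.lof k ℤ (fun n => K.X n) n a)
    have h2 := (DirectSum.lmap_lof (fun n => (f.f n).hom) n a).symm.trans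
      (h1.trans (DirectSum.lmap_lof (fun n => (g.f n).hom) n a))
    exact DirectSum.of_injective (β := fun n => L.X n) n h2

/-- A comodule morphism commutes with all coefficient operators. Those at `ξ^n` force it to preserve
degrees, those at `ψ ξ^n` force it to commute with the differential. -/
theorem full_totalComod (hc : ∀ i j, c.Rel i j → i - s = j) :
    (totalComod (k := k) (c := c) s).Full where
  map_surjective {K L} g := by
    let G : (DirectSum ℤ fun n => K.X n) →ₗ[k] (DirectSum ℤ fun n => L.X n) := g.hom.hom
    have hG (y) : totalCoact s L (G y) = G.lTensor _ (totalCoact s K y) :=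
      LinearMap.congr_fun g.isComodHom y
    -- The image of an element of degree `n` is again homogeneous of degree `n`.
    have h1 (n : ℤ) (a : K.X n) : DirectSum.lof k ℤ (fun n => L.X n) n
        (G (DirectSum.lof k ℤ (fun n => K.X n) n a) n) =
        G (DirectSum.lof k ℤ (fun n => K.X n) n a) := by
      rw [← coef_one_totalCoact s L, hG, coef_lTensor, coef_one_totalCoact, DirectSum.lof_apply]
    let g' (n : ℤ) : K.X n →ₗ[k] L.X n :=
      DirectSum.component k ℤ (fun n => L.X n) n ∘ₗ G ∘ₗ DirectSum.lof k ℤ (fun n => K.X n) n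
    refine ⟨⟨fun n => ModuleCat.ofHom (g' n), fun i j hij => ?_⟩, LeftComod.hom_ext
      (ModuleCat.hom_ext (DirectSum.linearMap_ext k fun n => LinearMap.ext fun a => ?_))⟩
    · obtain rfl := hc i j hij
      refine ModuleCat.hom_ext (LinearMap.ext fun a => DirectSum.of_injective (β := fun n => L.X n)
        (i - s) ?_)
      -- Comparison of the coefficients at `ψ ξ^(i - s)` yields the chain map condition inside the
      -- direct sum, where inclusions are injective.
      have h2 := coef_zero_totalCoact s L i (G (DirectSum.lof k ℤ (fun n => K.X n) i a))
      rw [hG, coef_lTensor, coef_zero_totalCoact, DirectSum.lof_apply, ← h1] at h2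
      exact h2.symm
    · exact (DirectSum.lmap_lof (fun n => g' n) n a).trans (h1 n a)

end TotalComodule

/-! ### From comodules to complexes: essential surjectivity -/

section EssSurj

open Par

variable {k : Type u} [CommRing k] {s : ℤˣ} (X : LeftComod k (Par k s))

namespace LeftComod

/-- The component of degree `n` of the coaction of a comodule over `Par k s`. -/
def proj (n : ℤ) : X.carrier →ₗ[k] X.carrier := coef k s _ (1, n) ∘ₗ X.coact

/-- The coefficient of `ψ ξ^n` in the coaction of a comodule over `Par k s`. -/
def diff (n : ℤ) : X.carrier →ₗ[k] X.carrier := coef k s _ (0, n) ∘ₗ X.coact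

/-- The four relations below are coassociativity read through the table of coefficients: orthogonal
idempotents, the source and the target degree of `diff`, and the vanishing of its square. -/
theorem proj_proj (m n : ℤ) (x : X.carrier) :
    X.proj m (X.proj n x) = if n = m then X.proj n x else 0 :=
  (coef_coef_coact X.isCoaction (1, n) (1, m) x).trans (coef_one_one_comul m n _)

theorem diff_proj (m n : ℤ) (x : X.carrier) :
    X.diff m (X.proj n x) = if n = s + m then X.diff m x else 0 :=
  (coef_coef_coact X.isCoaction (1, n) (0, m) x).trans (coef_zero_one_comul m n _)

theorem proj_diff (m n : ℤ) (x : X.carrier) :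
    X.proj m (X.diff n x) = if n = m then X.diff n x else 0 :=
  (coef_coef_coact X.isCoaction (0, n) (1, m) x).trans (coef_one_zero_comul m n _)

theorem diff_diff (m n : ℤ) (x : X.carrier) : X.diff m (X.diff n x) = 0 :=
  (coef_coef_coact X.isCoaction (0, n) (0, m) x).trans (coef_zero_zero_comul m n _)

/-- The differential of degree `-s` on the ranges of the projections. -/
def rangeDiff (i j : ℤ) : LinearMap.range (X.proj i) →ₗ[k] LinearMap.range (X.proj j) :=
  if i - s = j then LinearMap.codRestrict _ (X.diff j ∘ₗ (LinearMap.range (X.proj i)).subtype)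
    fun x => ⟨X.diff j x, by rw [proj_diff, if_pos rfl]; rfl⟩ else 0

theorem rangeDiff_apply (i : ℤ) (x : LinearMap.range (X.proj i)) :
    (X.rangeDiff i (i - s) x : X.carrier) = X.diff (i - s) x := by
  simp [rangeDiff]
  rfl

/-- The complex corresponding to a comodule over `Par k s`. -/
def toComplex {c : ComplexShape ℤ} (hc : ∀ i j : ℤ, i - s = j → c.Rel i j) :
    HomologicalComplex (ModuleCat.{u} k) c where
  X n := ModuleCat.of k (LinearMap.range (X.proj n))
  d i j := ModuleCat.ofHom (X.rangeDiff i j)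
  shape i j hij := by
    have : i - s ≠ j := fun h => hij (hc i j h)
    simp [rangeDiff, this]
  d_comp_d' i j l _ _ := by
    refine ModuleCat.hom_ext (LinearMap.ext fun x => Subtype.ext ?_)
    by_cases hij : i - s = j
    · subst hij
      by_cases hjl : i - s - s = l
      · subst hjl
        change (X.rangeDiff (i - s) (i - s - s) (X.rangeDiff i (i - s) x) : X.carrier) = 0
        rw [rangeDiff_apply, rangeDiff_apply, diff_diff]
      · simp [rangeDiff, hjl]
    · simp [rangeDiff, hij]

/-- A comodule over `Par k s` as the sum of the ranges of its projections. -/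
def fromSum : (DirectSum ℤ fun n => LinearMap.range (X.proj n)) →ₗ[k] X.carrier :=
  DirectSum.coeLinearMap fun n => LinearMap.range (X.proj n)

theorem fromSum_lof (n : ℤ) (x : LinearMap.range (X.proj n)) :
    X.fromSum (DirectSum.lof k ℤ _ n x) = x := DirectSum.coeLinearMap_lof _ _ _

theorem proj_coe (m n : ℤ) (x : LinearMap.range (X.proj n)) :
    X.proj m x = if n = m then (x : X.carrier) else 0 := by
  obtain ⟨_, y, rfl⟩ := x
  exact X.proj_proj m n y

theorem proj_fromSum (m : ℤ) (y : DirectSum ℤ fun n => LinearMap.range (X.proj n)) :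
    X.proj m (X.fromSum y) = y m := by
  induction y using DirectSum.induction_on with
  | zero => simp
  | add a b ha hb => simp [ha, hb]
  | of n a =>
    change X.proj m (X.fromSum (DirectSum.lof k ℤ _ n a)) = _
    rw [fromSum_lof, proj_coe]
    split_ifs with h
    · subst h; rw [DirectSum.of_eq_same]
    · rw [DirectSum.of_eq_of_ne _ _ _ (Ne.symm h)]; rfl

/-- Injective since the projections recover the components; surjective since the counit axiom
expresses `x` as the finite sum of its projections. -/
theorem fromSum_bijective : Function.Bijective X.fromSum := by
  constructor
  · refine fun y z h => DFinsupp.ext fun m => Subtype.ext ?_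
    exact (X.proj_fromSum m y).symm.trans ((congrArg (X.proj m) h).trans (X.proj_fromSum m z))
  · intro x
    have h := counit_mem (X.coact x) (LinearMap.range X.fromSum)
      fun n => ⟨DirectSum.lof k ℤ _ n ⟨X.proj n x, x, rfl⟩, X.fromSum_lof _ _⟩
    have h2 := LinearMap.congr_fun X.isCoaction.counit x
    simp only [LinearMap.comp_apply, LinearEquiv.coe_coe, LinearMap.id_apply] at h2
    rwa [h2] at h

theorem coact_coe (n : ℤ) (x : LinearMap.range (X.proj n)) :
    X.coact x = xiPow k s n ⊗ₜ (x : X.carrier) +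
      (psi k s * xiPow k s (n - s)) ⊗ₜ X.diff (n - s) x := by
  refine tensor_ext (fun m => ?_) (fun m => ?_)
  · rw [map_add, coef_one_xiPow, coef_one_psi, add_zero]
    exact X.proj_coe m n x
  · rw [map_add, coef_zero_xiPow, coef_zero_psi, zero_add]
    obtain ⟨_, y, rfl⟩ := x
    change X.diff m (X.proj n y) = if n - s = m then X.diff (n - s) (X.proj n y) else 0
    -- On the image of `proj n`, `diff m` vanishes unless `n = s + m`, so `ψ ξ^(n - s)` is the only
    -- term with `ψ`.
    rw [diff_proj, diff_proj, if_pos (by ring : n = s + (n - s))]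
    by_cases h : n - s = m
    · subst h; simp
    · rw [if_neg h, if_neg (by omega)]

/-- A comodule over `Par k s` is isomorphic to that of the corresponding complex. -/
def totalComodIso {c : ComplexShape ℤ} (hc : ∀ i j : ℤ, i - s = j → c.Rel i j) :
    (totalComod s).obj (X.toComplex hc) ≅ X :=
  mkIso (LinearEquiv.ofBijective X.fromSum X.fromSum_bijective).toModuleIso (by
    refine DirectSum.linearMap_ext k fun n => LinearMap.ext
      fun (x : LinearMap.range (X.proj n)) => ?_
    -- For `x` of degree `n` both composites equal `ξ^n ⊗ x + ψ ξ^(n - s) ⊗ diff (n - s) x`, by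
    -- `coact_coe` on one side and `totalCoact_lof` on the other.
    refine Eq.trans (b := X.coact (x : X.carrier)) (congrArg X.coact (X.fromSum_lof n x)) ?_
    refine Eq.trans ?_ (congrArg (X.fromSum.lTensor _)
      (totalCoact_lof s (X.toComplex hc) n x)).symm
    refine (X.coact_coe n x).trans (Eq.trans ?_ (map_add (X.fromSum.lTensor (Par k s)) _ _).symm)
    refine congrArg₂ (· + ·) (congrArg (xiPow k s n ⊗ₜ[k] ·) (X.fromSum_lof n x).symm)
      (congrArg ((psi k s * xiPow k s (n - s)) ⊗ₜ[k] ·) ?_)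
    exact ((X.fromSum_lof (n - s) (X.rangeDiff n (n - s) x)).trans
      (X.rangeDiff_apply n x)).symm)

end LeftComod

theorem isEquivalence_totalComod {c : ComplexShape ℤ} (hc : ∀ i j : ℤ, c.Rel i j ↔ i - s = j) :
    (totalComod (k := k) (c := c) s).IsEquivalence where
  full := full_totalComod s fun i j => (hc i j).1
  essSurj := ⟨fun X => ⟨X.toComplex fun i j => (hc i j).2, ⟨X.totalComodIso _⟩⟩⟩

end EssSurj

/-! ### Tensor products of complexes in terms of elements -/

section TensorComplex

open HomologicalComplex

variable {k : Type u} [CommRing k] {c : ComplexShape ℤ} [c.TensorSigns]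
  (K L M : HomologicalComplex (ModuleCat.{u} k) c)

/-- The element `a ⊗ b` of a tensor product of complexes. -/
def tmulX {i j n : ℤ} (h : i + j = n) : K.X i ⊗[k] L.X j →ₗ[k] (K ⊗ L).X n :=
  (ιTensorObj K L i j n h).hom

variable {K L M}

theorem tensorX_hom_ext {N : Type u} [AddCommGroup N] [Module k N] {n : ℤ}
    {f g : (K ⊗ L).X n →ₗ[k] N}
    (h : ∀ (i j : ℤ) (hij : i + j = n) (a : K.X i) (b : L.X j),
      f (tmulX K L hij (a ⊗ₜ b)) = g (tmulX K L hij (a ⊗ₜ b))) : f = g := by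
  have : ModuleCat.ofHom f = ModuleCat.ofHom g := by
    refine mapBifunctor.hom_ext (K₁ := K) (K₂ := L) (F := curriedTensor (ModuleCat k)) (c := c)
      fun i j hij => ModuleCat.hom_ext (TensorProduct.ext' fun a b => h i j hij a b)
  exact congrArg ModuleCat.Hom.hom this

/-- The linear map on a tensor product of complexes determined by its values on elements
`a ⊗ b`. -/
def tensorXDesc {N : Type u} [AddCommGroup N] [Module k N] {n : ℤ}
    (f : ∀ i j : ℤ, i + j = n → K.X i ⊗[k] L.X j →ₗ[k] N) : (K ⊗ L).X n →ₗ[k] N :=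
  (mapBifunctorDesc (K₁ := K) (K₂ := L) (F := curriedTensor (ModuleCat k)) (c := c)
    (A := ModuleCat.of k N) (j := n) fun i j h => ModuleCat.ofHom (f i j h)).hom

theorem tensorXDesc_tmulX {N : Type u} [AddCommGroup N] [Module k N] {n : ℤ}
    (f : ∀ i j : ℤ, i + j = n → K.X i ⊗[k] L.X j →ₗ[k] N) {i j : ℤ} (h : i + j = n)
    (z : K.X i ⊗[k] L.X j) : tensorXDesc f (tmulX K L h z) = f i j h z :=
  LinearMap.congr_fun (congrArg ModuleCat.Hom.hom (ι_mapBifunctorDesc (K₁ := K) (K₂ := L)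
    (F := curriedTensor (ModuleCat k)) (c := c) (A := ModuleCat.of k N)
    (fun i j h => ModuleCat.ofHom (f i j h)) i j h)) z

/-- Inside the direct sum the degree is no longer part of the type, so elements in propositionally
equal degrees can be compared without transport. -/
theorem lof_tmulX {i j n : ℤ} (h : i + j = n) (z : K.X i ⊗[k] L.X j) :
    DirectSum.lof k ℤ (fun n => (K ⊗ L).X n) n (tmulX K L h z) =
      DirectSum.lof k ℤ (fun n => (K ⊗ L).X n) (i + j) (tmulX K L rfl z) := by
  subst h; rfl

theorem whiskerRight_tmulX {K' : HomologicalComplex (ModuleCat.{u} k) c} (f : K ⟶ K')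
    {i j n : ℤ} (h : i + j = n) (a : K.X i) (b : L.X j) :
    ((f ▷ L).f n).hom (tmulX K L h (a ⊗ₜ b)) = tmulX K' L h ((f.f i).hom a ⊗ₜ b) := by
  have := LinearMap.congr_fun (congrArg ModuleCat.Hom.hom
    (ι_mapBifunctorMap f (𝟙 L) (curriedTensor (ModuleCat k)) c i j n h)) (a ⊗ₜ b)
  exact this

theorem whiskerLeft_tmulX {L' : HomologicalComplex (ModuleCat.{u} k) c} (f : L ⟶ L')
    {i j n : ℤ} (h : i + j = n) (a : K.X i) (b : L.X j) :
    ((K ◁ f).f n).hom (tmulX K L h (a ⊗ₜ b)) = tmulX K L' h (a ⊗ₜ (f.f j).hom b) := by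
  have := LinearMap.congr_fun (congrArg ModuleCat.Hom.hom
    (ι_mapBifunctorMap (𝟙 K) f (curriedTensor (ModuleCat k)) c i j n h)) (a ⊗ₜ b)
  exact this

theorem associator_tmulX {i j l n : ℤ} (h : i + j + l = n) (a : K.X i) (b : L.X j) (d : M.X l) :
    ((α_ K L M).hom.f n).hom (tmulX (K ⊗ L) M h (tmulX K L rfl (a ⊗ₜ b) ⊗ₜ d)) =
      tmulX K (L ⊗ M) ((add_assoc i j l).symm.trans h) (a ⊗ₜ tmulX L M rfl (b ⊗ₜ d)) := by
  have := LinearMap.congr_fun (congrArg ModuleCat.Hom.hom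
    (ι_mapBifunctorAssociatorX_hom (curriedAssociatorNatIso (ModuleCat k)) K L M c c c i j l n h))
    ((a ⊗ₜ b) ⊗ₜ d)
  exact this

/-- The element of degree `0` of the unit complex corresponding to a scalar. -/
def unitX : k →ₗ[k] (𝟙_ (HomologicalComplex (ModuleCat.{u} k) c)).X 0 :=
  (singleObjXSelf c 0 (𝟙_ (ModuleCat.{u} k))).inv.hom

theorem leftUnitor_inv_apply {n : ℤ} (a : K.X n) :
    ((λ_ K).inv.f n).hom a = tmulX (𝟙_ _) K (zero_add n) (unitX 1 ⊗ₜ a) :=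
  LinearMap.congr_fun (congrArg ModuleCat.Hom.hom (leftUnitor'_inv K n)) a

theorem rightUnitor_inv_apply {n : ℤ} (a : K.X n) :
    ((ρ_ K).inv.f n).hom a = tmulX K (𝟙_ _) (add_zero n) (a ⊗ₜ unitX 1) :=
  LinearMap.congr_fun (congrArg ModuleCat.Hom.hom (rightUnitor'_inv K n)) a

/-- Follows from the formula for the inverse. The scalar `1` suffices, since it generates `k` and
the maps are linear. -/
theorem leftUnitor_hom_apply {n : ℤ} (a : K.X n) :
    ((λ_ K).hom.f n).hom (tmulX (𝟙_ _) K (zero_add n) (unitX 1 ⊗ₜ a)) = a := by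
  rw [← leftUnitor_inv_apply, ← LinearMap.comp_apply, ← ModuleCat.hom_comp,
    ← HomologicalComplex.comp_f, Iso.inv_hom_id]
  rfl

theorem rightUnitor_hom_apply {n : ℤ} (a : K.X n) :
    ((ρ_ K).hom.f n).hom (tmulX K (𝟙_ _) (add_zero n) (a ⊗ₜ unitX 1)) = a := by
  rw [← rightUnitor_inv_apply, ← LinearMap.comp_apply, ← ModuleCat.hom_comp,
    ← HomologicalComplex.comp_f, Iso.inv_hom_id]
  rfl

theorem units_smul_hom_apply {A B : ModuleCat.{u} k} (e : ℤˣ) (f : A ⟶ B) (a : A) :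
    (e • f).hom a = e • f.hom a := by
  obtain rfl | rfl := Int.units_eq_one_or e <;> simp

/-- The differential of the tensor product is the sum of a part acting on the first factor and a
part acting on the second, each evaluated on one summand. -/
theorem d_tmulX {s : ℤˣ} (hc : ∀ i j, c.Rel i j ↔ i - s = j) {i j n : ℤ} (h : i + j = n)
    (a : K.X i) (b : L.X j) :
    ((K ⊗ L).d n (n - s)).hom (tmulX K L h (a ⊗ₜ b)) =
      tmulX K L (by omega) ((K.d i (i - s)).hom a ⊗ₜ b) +
        c.ε i • tmulX K L (by omega) (a ⊗ₜ (L.d j (j - s)).hom b) := by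
  have h1 := mapBifunctor.d₁_eq K L (curriedTensor (ModuleCat k)) c ((hc i (i - s)).2 rfl) j
    (n - s) (by change i - s + j = n - s; omega)
  have h2 := mapBifunctor.d₂_eq K L (curriedTensor (ModuleCat k)) c i ((hc j (j - s)).2 rfl)
    (n - s) (by change i + (j - s) = n - s; omega)
  have h3 := mapBifunctor.ι_D₁ K L (curriedTensor (ModuleCat k)) c n (n - s) i j h
  have h4 := mapBifunctor.ι_D₂ K L (curriedTensor (ModuleCat k)) c n (n - s) i j h
  rw [h1] at h3
  rw [h2] at h4
  have h5 := LinearMap.congr_fun (congrArg ModuleCat.Hom.hom h3) (a ⊗ₜ b)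
  have h6 := LinearMap.congr_fun (congrArg ModuleCat.Hom.hom h4) (a ⊗ₜ b)
  have h7 := LinearMap.congr_fun (congrArg ModuleCat.Hom.hom
    (mapBifunctor.d_eq K L (curriedTensor (ModuleCat k)) c n (n - s))) (tmulX K L h (a ⊗ₜ b))
  refine h7.trans (congrArg₂ (· + ·) (h5.trans ?_) (h6.trans ?_))
  -- The sign of the part acting on the first factor is `1`; only the second part carries `c.ε i`.
  · refine (units_smul_hom_apply _ _ _).trans ?_
    exact one_smul _ _
  · exact units_smul_hom_apply _ _ _

end TensorComplex

/-! ### The direct sum of components respects tensor products -/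

section TotalTensor

open Par

variable {k : Type u} [CommRing k] {c : ComplexShape ℤ}
  (K L M : HomologicalComplex (ModuleCat.{u} k) c)

/-- The underlying module of the comodule of a complex. -/
abbrev Total (K : HomologicalComplex (ModuleCat.{u} k) c) : Type u := DirectSum ℤ fun n => K.X n

/-- The inclusion of a component of a complex. -/
abbrev totalLof (n : ℤ) : K.X n →ₗ[k] Total K := DirectSum.lof k ℤ (fun n => K.X n) n

variable {K} in
theorem total_hom_ext {N : Type*} [AddCommMonoid N] [Module k N] {f g : Total K →ₗ[k] N}
    (h : ∀ n a, f (totalLof K n a) = g (totalLof K n a)) : f = g :=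
  DirectSum.linearMap_ext k fun n => LinearMap.ext (h n)

variable [c.TensorSigns]

/-- The comparison map from the tensor product of the total modules of complexes. -/
def totalMu : Total K ⊗[k] Total L →ₗ[k] Total (K ⊗ L) :=
  DirectSum.toModule k (ℤ × ℤ) _ (fun p => totalLof (K ⊗ L) (p.1 + p.2) ∘ₗ tmulX K L rfl) ∘ₗ
    (TensorProduct.directSum k k (fun n => K.X n) (fun n => L.X n)).toLinearMap

/-- The inverse of `totalMu`. -/
def totalMuInv : Total (K ⊗ L) →ₗ[k] Total K ⊗[k] Total L :=
  DirectSum.toModule k ℤ _ fun _ => tensorXDesc fun i j _ =>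
    TensorProduct.map (totalLof K i) (totalLof L j)

variable {K L M}

theorem totalMu_tmul {i j : ℤ} (a : K.X i) (b : L.X j) :
    totalMu K L (totalLof K i a ⊗ₜ totalLof L j b) =
      totalLof (K ⊗ L) (i + j) (tmulX K L rfl (a ⊗ₜ b)) := by
  simp only [totalMu, LinearMap.comp_apply, LinearEquiv.coe_coe,
    TensorProduct.directSum_lof_tmul_lof, DirectSum.toModule_lof]

theorem totalMuInv_lof {i j n : ℤ} (h : i + j = n) (a : K.X i) (b : L.X j) :
    totalMuInv K L (totalLof (K ⊗ L) n (tmulX K L h (a ⊗ₜ b))) =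
      totalLof K i a ⊗ₜ totalLof L j b := by
  simp only [totalMuInv, DirectSum.toModule_lof, tensorXDesc_tmulX, TensorProduct.map_tmul]

theorem totalMuInv_comp_totalMu : totalMuInv K L ∘ₗ totalMu K L = LinearMap.id := by
  refine TensorProduct.ext (total_hom_ext fun i a => total_hom_ext fun j b => ?_)
  simp only [LinearMap.compr₂ₛₗ_apply, TensorProduct.mk_apply, LinearMap.comp_apply,
    totalMu_tmul, totalMuInv_lof, LinearMap.id_apply]

theorem totalMu_comp_totalMuInv : totalMu K L ∘ₗ totalMuInv K L = LinearMap.id := by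
  refine DirectSum.linearMap_ext k fun n => tensorX_hom_ext fun i j hij a b => ?_
  simp only [LinearMap.comp_apply, totalMu_tmul, totalMuInv_lof, LinearMap.id_apply]
  rw [← lof_tmulX hij]

variable (K L) in
/-- The comparison isomorphism from the tensor product of the total modules of complexes. -/
def totalMuEquiv : (Total K ⊗[k] Total L) ≃ₗ[k] Total (K ⊗ L) :=
  LinearEquiv.ofLinearMap (totalMu K L) (totalMuInv K L) totalMu_comp_totalMuInv
    totalMuInv_comp_totalMu

/-- Multiplying the coactions of `a` and `b` gives four terms. The one with `da ⊗ db` has two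
factors `ψ` and vanishes; in the one with `a ⊗ db`, moving `ξ^i` past `ψ` yields `(-1)^i`. The rest
is the coaction of `a ⊗ b` with the tensor differential. -/
theorem isComodHom_totalMu {s : ℤˣ} (hc : ∀ i j, c.Rel i j ↔ i - s = j)
    (hε : ∀ n, c.ε n = n.negOnePow) :
    IsComodHom (coactTensor (totalCoact s K) (totalCoact s L)) (totalCoact s (K ⊗ L))
      (totalMu K L) := by
  refine TensorProduct.ext (total_hom_ext fun i a => total_hom_ext fun j b => ?_)
  have hi : i - s + j = i + j - s := by ring
  have hj : i + (j - s) = i + j - s := by ring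
  simp only [LinearMap.compr₂ₛₗ_apply, TensorProduct.mk_apply, LinearMap.comp_apply,
    totalMu_tmul, coactTensor_tmul, totalCoact_lof, d_tmulX hc, tmul_add, add_tmul, map_add,
    mulOut_tmul, LinearMap.lTensor_tmul, mul_assoc, psi_mul_xiPow_mul_psi, zero_tmul, add_zero,
    ← xiPow_add, hi]
  -- Only the term `a ⊗ db` still has `ξ^i` to the left of `ψ`.
  rw [← mul_assoc, xiPow_mul_psi, smul_mul_assoc, mul_assoc, ← xiPow_add,
    show xiPow k s (i + (j - s)) = xiPow k s (i + j - s) by rw [hj],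
    ← lof_tmulX hi]
  rw [← lof_tmulX hj, hε, ← sgn_smul (k := k), map_smul, smul_tmul, add_assoc]

variable (s : ℤˣ)

theorem totalMu_natural_left {K' : HomologicalComplex (ModuleCat.{u} k) c} (f : K ⟶ K')
    (x : Total K) (y : Total L) :
    totalMu K' L (DirectSum.lmap (fun n => (f.f n).hom) x ⊗ₜ y) =
      DirectSum.lmap (fun n => ((f ▷ L).f n).hom) (totalMu K L (x ⊗ₜ y)) := by
  refine LinearMap.congr_fun₂ (f := (TensorProduct.mk k _ _).compr₂ (totalMu K' L) ∘ₗ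
    DirectSum.lmap (fun n => (f.f n).hom)) (g := (TensorProduct.mk k _ _).compr₂
    (DirectSum.lmap (fun n => ((f ▷ L).f n).hom) ∘ₗ totalMu K L))
    (total_hom_ext fun i a => total_hom_ext fun j b => ?_) x y
  simp only [LinearMap.compr₂_apply, TensorProduct.mk_apply, LinearMap.comp_apply,
    DirectSum.lmap_lof, totalMu_tmul, whiskerRight_tmulX]

theorem totalMu_natural_right {L' : HomologicalComplex (ModuleCat.{u} k) c} (f : L ⟶ L')
    (x : Total K) (y : Total L) :
    totalMu K L' (x ⊗ₜ DirectSum.lmap (fun n => (f.f n).hom) y) =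
      DirectSum.lmap (fun n => ((K ◁ f).f n).hom) (totalMu K L (x ⊗ₜ y)) := by
  refine LinearMap.congr_fun₂ (f := ((TensorProduct.mk k _ _).compr₂ (totalMu K L')).compl₂
    (DirectSum.lmap (fun n => (f.f n).hom))) (g := (TensorProduct.mk k _ _).compr₂
    (DirectSum.lmap (fun n => ((K ◁ f).f n).hom) ∘ₗ totalMu K L))
    (total_hom_ext fun i a => total_hom_ext fun j b => ?_) x y
  simp only [LinearMap.compr₂_apply, LinearMap.compl₂_apply, TensorProduct.mk_apply,
    LinearMap.comp_apply, DirectSum.lmap_lof, totalMu_tmul, whiskerLeft_tmulX]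

theorem totalMu_associativity (x : Total K) (y : Total L) (z : Total M) :
    DirectSum.lmap (fun n => ((α_ K L M).hom.f n).hom)
      (totalMu (K ⊗ L) M (totalMu K L (x ⊗ₜ y) ⊗ₜ z)) =
    totalMu K (L ⊗ M) (x ⊗ₜ totalMu L M (y ⊗ₜ z)) := by
  refine LinearMap.congr_fun (f := DirectSum.lmap (fun n => ((α_ K L M).hom.f n).hom) ∘ₗ
    totalMu (K ⊗ L) M ∘ₗ (totalMu K L).rTensor _) (g := totalMu K (L ⊗ M) ∘ₗ
    (totalMu L M).lTensor _ ∘ₗ (TensorProduct.assoc k _ _ _).toLinearMap)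
    (TensorProduct.ext (TensorProduct.ext (total_hom_ext fun i a => total_hom_ext fun j b =>
      total_hom_ext fun l d => ?_))) ((x ⊗ₜ y) ⊗ₜ z)
  simp only [LinearMap.compr₂ₛₗ_apply, TensorProduct.mk_apply, LinearMap.comp_apply,
    LinearMap.rTensor_tmul, LinearMap.lTensor_tmul, LinearEquiv.coe_coe, TensorProduct.assoc_tmul,
    totalMu_tmul, DirectSum.lmap_lof]
  -- The degrees `i + j + l` and `i + (j + l)` are reconciled inside the direct sum.
  rw [associator_tmulX, lof_tmulX]

/-- The unit comparison map. -/
def totalEps : k →ₗ[k] Total (𝟙_ (HomologicalComplex (ModuleCat.{u} k) c)) :=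
  totalLof _ 0 ∘ₗ unitX

theorem unitX_bijective :
    Function.Bijective (unitX (k := k) (c := c)) :=
  (HomologicalComplex.singleObjXSelf c 0 (𝟙_ (ModuleCat.{u} k))).symm.toLinearEquiv.bijective

/-- The unit complex is `k` in degree `0` and zero elsewhere, so its total module is `k`. -/
theorem totalEps_bijective : Function.Bijective (totalEps (k := k) (c := c)) := by
  refine ⟨(DirectSum.of_injective
    (β := fun n => (𝟙_ (HomologicalComplex (ModuleCat.{u} k) c)).X n) 0).comp unitX_bijective.1,
    fun y => ?_⟩
  induction y using DirectSum.induction_on with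
  | zero => exact ⟨0, map_zero _⟩
  | add a b ha hb =>
    obtain ⟨a, rfl⟩ := ha
    obtain ⟨b, rfl⟩ := hb
    exact ⟨a + b, map_add _ _ _⟩
  | of n a =>
    by_cases hn : n = 0
    · subst hn
      obtain ⟨r, rfl⟩ := unitX_bijective.2 a
      exact ⟨r, rfl⟩
    · have := ModuleCat.subsingleton_of_isZero
        (HomologicalComplex.isZero_single_obj_X c 0 (𝟙_ (ModuleCat.{u} k)) n hn)
      have ha : a = 0 := Subsingleton.elim (α := (((HomologicalComplex.single (ModuleCat.{u} k) c
        0).obj (𝟙_ (ModuleCat.{u} k))).X n : Type u)) _ _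
      exact ⟨0, by rw [ha, map_zero, map_zero]⟩

/-- The unit complex has zero differential and sits in degree `0`, where the coaction is by `ξ^0 =
1`. -/
theorem isComodHom_totalEps :
    IsComodHom (coactUnit k (Par k s)) (totalCoact s (𝟙_ (HomologicalComplex (ModuleCat.{u} k) c)))
      totalEps := by
  refine LinearMap.ext_ring ?_
  have h : ((𝟙_ (HomologicalComplex (ModuleCat.{u} k) c)).d 0 (0 - s)).hom (unitX 1) = 0 :=
    LinearMap.congr_fun (congrArg ModuleCat.Hom.hom
      (HomologicalComplex.single_obj_d c 0 (𝟙_ (ModuleCat.{u} k)) 0 (0 - s))) (unitX 1)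
  simp only [totalEps, LinearMap.comp_apply, totalCoact_lof, h, map_zero, tmul_zero, add_zero,
    coactUnit_apply, LinearMap.lTensor_tmul, xiPow_zero]

theorem totalMu_left_unitality (r : k) (x : Total K) :
    r • x = DirectSum.lmap (fun n => ((λ_ K).hom.f n).hom)
      (totalMu (𝟙_ _) K (totalEps r ⊗ₜ x)) := by
  refine LinearMap.congr_fun₂ (f := LinearMap.lsmul k (Total K))
    (g := (TensorProduct.mk k _ _).compr₂ (DirectSum.lmap (fun n => ((λ_ K).hom.f n).hom) ∘ₗ
      totalMu (𝟙_ _) K) ∘ₗ totalEps)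
    (LinearMap.ext_ring (total_hom_ext fun n a => ?_)) r x
  simp only [LinearMap.compr₂_apply, TensorProduct.mk_apply, LinearMap.comp_apply, totalEps,
    totalMu_tmul, LinearMap.lsmul_apply, one_smul]
  rw [← lof_tmulX (zero_add n), DirectSum.lmap_lof, leftUnitor_hom_apply]

theorem totalMu_right_unitality (r : k) (x : Total K) :
    r • x = DirectSum.lmap (fun n => ((ρ_ K).hom.f n).hom)
      (totalMu K (𝟙_ _) (x ⊗ₜ totalEps r)) := by
  refine LinearMap.congr_fun₂ (f := LinearMap.lsmul k (Total K))
    (g := (TensorProduct.mk k _ _).flip.compr₂ (DirectSum.lmap (fun n => ((ρ_ K).hom.f n).hom) ∘ₗ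
      totalMu K (𝟙_ _)) ∘ₗ totalEps)
    (LinearMap.ext_ring (total_hom_ext fun n a => ?_)) r x
  simp only [LinearMap.compr₂_apply, LinearMap.flip_apply, TensorProduct.mk_apply,
    LinearMap.comp_apply, totalEps, totalMu_tmul, LinearMap.lsmul_apply, one_smul]
  rw [← lof_tmulX (add_zero n), DirectSum.lmap_lof, rightUnitor_hom_apply]


end TotalTensor

/-! ### The monoidal equivalence -/

section MonoidalTotal

open Par

variable {k : Type u} [CommRing k] {c : ComplexShape ℤ} [c.TensorSigns] {s : ℤˣ}

/-- The monoidal structure on the functor from complexes to comodules. -/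
def coreMonoidalTotalComod (hc : ∀ i j, c.Rel i j ↔ i - s = j) (hε : ∀ n, c.ε n = n.negOnePow) :
    (totalComod (k := k) (c := c) s).CoreMonoidal where
  εIso := LeftComod.mkIso (LinearEquiv.ofBijective totalEps totalEps_bijective).toModuleIso
    (isComodHom_totalEps s)
  μIso K L := LeftComod.mkIso (totalMuEquiv K L).toModuleIso (isComodHom_totalMu hc hε)
  μIso_hom_natural_left {K K'} f L := LeftComod.hom_ext (ModuleCat.hom_ext (TensorProduct.ext'
    fun x y => totalMu_natural_left (L := L) f x y))
  μIso_hom_natural_right {L L'} K f := LeftComod.hom_ext (ModuleCat.hom_ext (TensorProduct.ext'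
    fun x y => totalMu_natural_right (K := K) f x y))
  associativity K L M := LeftComod.hom_ext (ModuleCat.hom_ext (TensorProduct.ext_threefold
    fun x y z => totalMu_associativity (K := K) (L := L) (M := M) x y z))
  left_unitality K := by
    refine LeftComod.hom_ext (ModuleCat.hom_ext (TensorProduct.ext' fun r x => ?_))
    refine (lid_tmul x r).trans ?_
    have h := totalMu_left_unitality (K := K) r x
    refine h.trans ?_
    rfl
  right_unitality K := by
    refine LeftComod.hom_ext (ModuleCat.hom_ext (TensorProduct.ext' fun x r => ?_))
    refine (rid_tmul x r).trans ?_
    have h := totalMu_right_unitality (K := K) r x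
    refine h.trans ?_
    rfl

/-- The module underlying `totalComod` is the direct sum of components by definition, so the
comparison with `totalSum` is the identity and the coaction formula is `totalCoact_lof`. -/
theorem comodulesAreComplexes (hc : ∀ i j, c.Rel i j ↔ i - s = j)
    (hε : ∀ n, c.ε n = n.negOnePow) : ComodulesAreComplexes k s c := by
  have := isEquivalence_totalComod (k := k) hc
  exact ⟨(totalComod s).asEquivalence, Iso.refl _, ⟨(coreMonoidalTotalComod (k := k) hc hε).toMonoidal⟩,
    fun K n a => totalCoact_lof s K n a⟩

end MonoidalTotal

end Pareigis

end

theorem mainTheorem4 :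
    IsBraidingCoelement (gamma ℤ) ∧
    (∀ s : ℤˣ,
      (IsCoaction (coactDegree ℤ s) ∧
        braiding (gamma ℤ) (coactDegree ℤ s) (coactDegree ℤ s) = -LinearMap.id ∧
        (sumHopf ℤ ℤ).IsHopfComodule (gamma ℤ) (coactH ℤ s)) ∧
      (semidirectQ ℤ s).IsHopfRing ∧
      ((∀ j, (semidirectQ ℤ s).counit (Q.dx ℤ j) = 0) ∧
        (∀ j, (semidirectQ ℤ s).counit (Q.x ℤ j) = 1)) ∧
      (semidirectQ ℤ s).unit 1 = Q.x ℤ 0 ∧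
      ((∀ j, (semidirectQ ℤ s).comul (Q.x ℤ j) = Q.x ℤ j ⊗ₜ Q.x ℤ j) ∧
        (∀ j, (semidirectQ ℤ s).comul (Q.dx ℤ j) =
          Q.dx ℤ j ⊗ₜ Q.x ℤ j + Q.x ℤ (s + j) ⊗ₜ Q.dx ℤ j)) ∧
      ((∀ j l, (semidirectQ ℤ s).mul (Q.dx ℤ j ⊗ₜ Q.dx ℤ l) = 0) ∧
        (∀ j l, (semidirectQ ℤ s).mul (Q.dx ℤ j ⊗ₜ Q.x ℤ l) = Q.dx ℤ (j + l)) ∧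
        (∀ j l, (semidirectQ ℤ s).mul (Q.x ℤ j ⊗ₜ Q.dx ℤ l) = j.negOnePow • Q.dx ℤ (j + l)) ∧
        (∀ j l, (semidirectQ ℤ s).mul (Q.x ℤ j ⊗ₜ Q.x ℤ l) = Q.x ℤ (j + l))) ∧
      ((∀ j, (semidirectQ ℤ s).antipode (Q.dx ℤ j) = j.negOnePow • Q.dx ℤ (-j - s)) ∧
        (∀ j, (semidirectQ ℤ s).antipode (Q.x ℤ j) = Q.x ℤ (-j))) ∧
      ∃ e : HopfIso (semidirectQ ℤ s) (HopfData.of ℤ (Par ℤ s)),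
        e.toLinearEquiv (Q.x ℤ 1) = Par.xi ℤ s ∧ e.toLinearEquiv (Q.dx ℤ 0) = Par.psi ℤ s) ∧
    (∃ e : HopfIso (HopfData.of ℤ (Par ℤ (-1))) (HopfData.of ℤ (Par ℤ 1)),
      e.toLinearEquiv (Par.xi ℤ (-1)) = ((Par.xi ℤ 1)⁻¹ : (Par ℤ 1)ˣ) ∧
      e.toLinearEquiv ((Par.xi ℤ (-1))⁻¹ : (Par ℤ (-1))ˣ) = Par.xi ℤ 1 ∧
      e.toLinearEquiv (Par.psi ℤ (-1)) = Par.psi ℤ 1) ∧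
    ComodulesAreComplexes ℤ (-1) (ComplexShape.up ℤ) ∧
    ComodulesAreComplexes ℤ 1 (ComplexShape.down ℤ) := by
  refine ⟨isBraidingCoelement_gamma, fun s => ⟨⟨isCoaction_coactDegree _,
    braiding_coactDegree s, isHopfComodule_sumHopf s⟩, isHopfRing_semidirectQ s,
    ⟨semidirectQ_counit_dx s, semidirectQ_counit_x s⟩, semidirectQ_unit_one s,
    ⟨semidirectQ_comul_x s, semidirectQ_comul_dx s⟩,
    ⟨semidirectQ_mul_dx_dx s, semidirectQ_mul_dx_x s,
      fun j l => (semidirectQ_mul_x_dx s j l).trans (sgn_smul _ _), semidirectQ_mul_x_x s⟩,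
    ⟨fun j => (semidirectQ_antipode_dx s j).trans (sgn_smul _ _), semidirectQ_antipode_x s⟩,
    Par.hopfIsoQ ℤ s, (Par.equivQ_x s 1).trans (Par.xiPow_one s),
    (Par.equivQ_dx s 0).trans (by rw [Par.xiPow_zero, mul_one])⟩,
    ⟨Par.flipIso ℤ (by simp), Par.flip_xi _ 1, ?_, Par.flip_psi _ 1⟩,
    -- The relation `i - s = j` is `i + 1 = j` for `s = -1` and `j + 1 = i` for `s = 1`; in both
    -- shapes the tensor sign is `(-1)^n` by definition.
    comodulesAreComplexes (fun i j => ?_) fun _ => rfl,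
    comodulesAreComplexes (fun i j => ?_) fun _ => rfl⟩
  · rw [← Par.xiPow_neg_one]
    exact (Par.flip_xiPow _ 1 (-1)).trans (Par.xiPow_one 1)
  · simp
  · simp only [ComplexShape.down_Rel, Units.val_one]
    lia
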